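/- Let $\mathscr C$ be an additive category, $n\ge 1$, $\mathbb E:\mathscr C^{op}\times\mathscr C\to Ab$ a biadditive functor, and write $a_*\delta$, $c^*\delta$ for the action of morphisms on elements of $\mathbb E(C,A)$. **Complexes.** Complexes are of the form $X^0\to X^1\to\cdots\to X^{n+1}$, with differentials $d_X^i$. For such complexes with $X^0=A$ and $X^{n+1}=C$, $[X]$ denotes the class of $X$ under homotopy equivalences which, together with a homotopy inverse, are the identity on $A$ and on $C$. $X$ is an *$n$-kernel sequence* if $0\to\mathscr C(-,X^0)\to\cdots\to\mathscr C(-,X^{n+1})$ is exact, an *$n$-cokernel sequence* if $0\to\mathscr C(X^{n+1},-)\to\cdots\to\mathscr C(X^0,-)$ is exact, and *$n$-exact* if it is both. The *mapping cone* of $f:X\to Y$ is $$M_f:\ X^1\to X^2\oplus Y^1\to\cdots\to X^{n+1}\oplus Y^n\to Y^{n+1},\qquad d^0=\begin{bmatrix}-d_X^1\\ f^1\end{bmatrix},\quad d^i=\begin{bmatrix}-d_X^{i+1}&0\\ f^{i+1}&d_Y^i\end{bmatrix}\ (1\le i\le n-1),\quad d^n=\begin{bmatrix}f^{n+1}&d_Y^n\end{bmatrix};$$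 the *mapping cocone* is the dual complex $N_f:\ X^0\to X^1\oplus Y^0\to\cdots\to X^n\oplus Y^{n-1}\to Y^n$. **$n$-exangulated categories.** Let $\mathfrak s$ assign to every $\delta\in\mathbb E(C,A)$ a class $\mathfrak s(\delta)=[X]$ with $X^0=A$, $X^{n+1}=C$. Then $(\mathscr C,\mathbb E,\mathfrak s)$ is *$n$-exangulated* if the following hold. * (R0) If $\mathfrak s(\delta)=[X]$, $\mathfrak s(\rho)=[Y]$ and $a_*\delta=c^*\rho$, there is $f:X\to Y$ with $f^0=a$, $f^{n+1}=c$. * (R1) If $\mathfrak s(\delta)=[X]$, then $\mathscr C(-,X^0)\to\cdots\to\mathscr C(-,X^{n+1})\to\mathbb E(-,X^0)$ and $\mathscr C(X^{n+1},-)\to\cdots\to\mathscr C(X^0,-)\to\mathbb E(X^{n+1},-)$ are exact, the last maps being $g\mapsto g^*\delta$ and $g\mapsto g_*\delta$. * (R2) $\mathfrak s(0)=[A\xrightarrow{1}A\to0\to\cdots\to0]$ for $0\in\mathbb E(0,A)$, and $\mathfrak s(0)=[0\to\cdots\to0\to A\xrightarrow{1}A]$ for $0\in\mathbb E(A,0)$.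 * (EA1) Inflations are closed under composition, and so are deflations. Here a *conflation* is an $X$ with $\mathfrak s(\delta)=[X]$ for some $\delta\in\mathbb E(X^{n+1},X^0)$, and an *inflation* (*deflation*) is a morphism of the form $d_X^0$ ($d_X^n$) for a conflation $X$. * (EA2) If $\rho\in\mathbb E(D,A)$, $c:C\to D$, $\mathfrak s(c^*\rho)=[X]$ and $\mathfrak s(\rho)=[Y]$, there is $f:X\to Y$ with $f^0=1_A$, $f^{n+1}=c$ and $\mathfrak s((d_X^0)_*\rho)=[M_f]$. * (EA2$^{op}$) The dual of (EA2), with mapping cocones. **Conditions.** Let $\mathcal X$ be a class of $n$-exact sequences. An *$\mathcal X$-admissible monomorphism* (*epimorphism*) is a morphism of the form $d_X^0$ ($d_X^n$) with $X\in\mathcal X$. * (EC$'$) If $X\in\mathcal X$ and $[X]=[Y]$, then $Y\in\mathcal X$. * (E0) The sequence $0\to0\to\cdots\to0$ belongs to $\mathcal X$. * (E1) $\mathcal X$-admissible monomorphisms are closed under composition. (E1$^{op}$) So are $\mathcal X$-admissible epimorphisms. * (E2$'^{op}$) (i) For every $Y\in\mathcal X$ with end terms $A,C$ and every $c:C'\to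 C$ there are $X\in\mathcal X$ with end terms $A,C'$ and $f:X\to Y$ with $f^0=1_A$, $f^{n+1}=c$. (ii) If $X,Y\in\mathcal X$ have $X^0=Y^0=A$ and $f:X\to Y$ satisfies $f^0=1_A$, then $M_f\in\mathcal X$. * (E2$'$) The dual of (E2$'^{op}$). * (EI) If $X\in\mathcal X$, $X'$ is an $n$-exact sequence with the same end terms $A,C$, and there is a morphism $X\to X'$ or $X'\to X$ that is the identity on $A$ and $C$, then $[X]=[X']$. $(\mathscr C,\mathcal X)$ is an *$n$-exact category* (Jasso) if (E0), (E1), (E1$^{op}$) hold, together with: * (EC) For every morphism $f:X\to Y$ of $n$-exact sequences such that $f^k,f^{k+1}$ are isomorphisms for some $0\le k\le n$, or such that $f^0,f^{n+1}$ are isomorphisms: $X\in\mathcal X$ if and only if $Y\in\mathcal X$. * (E2) For all $X\in\mathcal X$ and $f^0:X^0\to Y^0$ there is a commutative diagram $(f^0,\dots,f^n)$ from $X^0\to\cdots\to X^n$ to a sequence $Y^0\to\cdots\to Y^n$ which is an $n$-pushout diagram, i.e. whose sequence $X^0\to X^1\oplus Y^0\to\cdots\to X^n\oplus Y^{n-1}\to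 Y^n$ is an $n$-cokernel sequence, and in which $Y^0\to Y^1$ is an $\mathcal X$-admissible monomorphism. * (E2$^{op}$) The dual of (E2), with $n$-pullback diagrams and $\mathcal X$-admissible epimorphisms. **Proposition.** Let $(\mathscr C,\mathbb E,\mathfrak s)$ be an $n$-exangulated category in which every inflation is a monomorphism and every deflation is an epimorphism, and let $\mathcal X$ be the class of all conflations. 1. All members of $\mathcal X$ are $n$-exact sequences, and $(\mathscr C,\mathcal X)$ satisfies (EC$'$), (E0), (E1), (E1$^{op}$), (E2$'$) and (E2$'^{op}$). 2. Suppose moreover that for all morphisms $A\xrightarrow{a}B\xrightarrow{b}C$ in $\mathscr C$: (a) if $b\circ a$ is an inflation, then so is $a$; (b) if $b\circ a$ is a deflation, then so is $b$. Then $(\mathscr C,\mathcal X)$ also satisfies (EI) and is an $n$-exact category. -/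

import Mathlib

open CategoryTheory CategoryTheory.Limits

namespace NExangulated

universe w v u

noncomputable section

section Complexes

variable {𝒞 : Type u} [Category.{v} 𝒞] [Preadditive 𝒞]

/-! ### Complexes concentrated in degrees `0, …, n + 1` -/

/-- A complex `X⁰ ⟶ X¹ ⟶ ⋯ ⟶ Xⁿ⁺¹` in `𝒞`: a cochain complex whose components are zero in
the degrees outside of `{0, …, n + 1}`. Morphisms and homotopies are those of the underlying
cochain complexes. -/
structure Cplx (𝒞 : Type u) [Category.{v} 𝒞] [Preadditive 𝒞] (n : ℕ) where
  K : CochainComplex 𝒞 ℕ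
  isZero : ∀ i, n + 1 < i → IsZero (K.X i)

/-- The component in degree `i`. -/
abbrev Cplx.X {n : ℕ} (X : Cplx 𝒞 n) (i : ℕ) : 𝒞 := X.K.X i

/-- The differential from degree `i` to degree `i + 1`. -/
abbrev Cplx.d {n : ℕ} (X : Cplx 𝒞 n) (i : ℕ) : X.X i ⟶ X.X (i + 1) := X.K.d i (i + 1)

/-- Complexes with prescribed end terms `X⁰ = A` and `Xⁿ⁺¹ = C`. -/
structure Ends (n : ℕ) (A C : 𝒞) extends Cplx 𝒞 n where
  h₀ : K.X 0 = A
  h₁ : K.X (n + 1) = C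

/-- A complex, regarded as a complex with its own end terms. -/
def Cplx.ends {n : ℕ} (X : Cplx 𝒞 n) : Ends n (X.X 0) (X.X (n + 1)) where
  toCplx := X
  h₀ := rfl
  h₁ := rfl

/-- The component `f⁰ : A ⟶ B` of a morphism `f` of complexes with `X⁰ = A`, `Y⁰ = B`. -/
def left {n : ℕ} {A B C D : 𝒞} {X : Ends n A C} {Y : Ends n B D} (f : X.K ⟶ Y.K) : A ⟶ B :=
  eqToHom X.h₀.symm ≫ f.f 0 ≫ eqToHom Y.h₀

/-- The component `fⁿ⁺¹ : C ⟶ D` of a morphism `f` of complexes with `Xⁿ⁺¹ = C`, `Yⁿ⁺¹ = D`. -/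
def right {n : ℕ} {A B C D : 𝒞} {X : Ends n A C} {Y : Ends n B D} (f : X.K ⟶ Y.K) : C ⟶ D :=
  eqToHom X.h₁.symm ≫ f.f (n + 1) ≫ eqToHom Y.h₁

/-- The first differential `A ⟶ X¹`. -/
def Ends.first {n : ℕ} {A C : 𝒞} (X : Ends n A C) : A ⟶ X.X 1 :=
  eqToHom X.h₀.symm ≫ X.d 0

/-- The last differential `Xⁿ ⟶ C`. -/
def Ends.last {n : ℕ} {A C : 𝒞} (X : Ends n A C) : X.X n ⟶ C :=
  X.d n ≫ eqToHom X.h₁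

/-- A morphism of complexes with the same end terms `A`, `C` that is the identity on both. -/
def IsEndsHom {n : ℕ} {A C : 𝒞} {X Y : Ends n A C} (f : X.K ⟶ Y.K) : Prop :=
  left (X := X) (Y := Y) f = 𝟙 A ∧ right (X := X) (Y := Y) f = 𝟙 C

/-- Homotopic equivalence of complexes with fixed end terms: a homotopy equivalence which,
together with a homotopy inverse, is the identity on both end terms. -/
def EndsEquiv {n : ℕ} {A C : 𝒞} (X Y : Ends n A C) : Prop :=
  ∃ e : HomotopyEquiv X.K Y.K,
    IsEndsHom (X := X) (Y := Y) e.hom ∧ IsEndsHom (X := Y) (Y := X) e.inv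

lemma isEndsHom_id {n : ℕ} {A C : 𝒞} (X : Ends n A C) : IsEndsHom (X := X) (Y := X) (𝟙 X.K) := by
  simp [IsEndsHom, left, right]

lemma IsEndsHom.comp {n : ℕ} {A C : 𝒞} {X Y Z : Ends n A C} {f : X.K ⟶ Y.K} {g : Y.K ⟶ Z.K}
    (hf : IsEndsHom (X := X) (Y := Y) f) (hg : IsEndsHom (X := Y) (Y := Z) g) :
    IsEndsHom (X := X) (Y := Z) (f ≫ g) := by
  constructor
  · have : left (X := X) (Y := Z) (f ≫ g) =
        left (X := X) (Y := Y) f ≫ left (X := Y) (Y := Z) g := by simp [left]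
    rw [this, hf.1, hg.1, Category.comp_id]
  · have : right (X := X) (Y := Z) (f ≫ g) =
        right (X := X) (Y := Y) f ≫ right (X := Y) (Y := Z) g := by simp [right]
    rw [this, hf.2, hg.2, Category.comp_id]

/-- Homotopic equivalence is an equivalence relation on complexes with end terms `A`, `C`. -/
instance endsSetoid (n : ℕ) (A C : 𝒞) : Setoid (Ends n A C) where
  r := EndsEquiv
  iseqv :=
    { refl := fun X => ⟨HomotopyEquiv.refl X.K, isEndsHom_id X, isEndsHom_id X⟩
      symm := fun ⟨e, h, h'⟩ => ⟨e.symm, h', h⟩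
      trans := fun ⟨e, h, h'⟩ ⟨e₂, h₂, h₂'⟩ => ⟨e.trans e₂, h.comp h₂, h₂'.comp h'⟩ }

/-- The homotopic equivalence classes `[X]` of complexes with end terms `A`, `C`. -/
abbrev HtpyClass (n : ℕ) (A C : 𝒞) : Type (max u v) := Quotient (endsSetoid n A C)

/-- The homotopic equivalence class `[X]`. -/
abbrev Ends.cls {n : ℕ} {A C : 𝒞} (X : Ends n A C) : HtpyClass n A C := Quotient.mk _ X

/-! ### `n`-exact sequences -/

/-- `n`-kernel sequences: `0 ⟶ 𝒞(-, X⁰) ⟶ 𝒞(-, X¹) ⟶ ⋯ ⟶ 𝒞(-, Xⁿ⁺¹)` is exact. -/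
def Cplx.IsNKernel {n : ℕ} (X : Cplx 𝒞 n) : Prop :=
  ∀ Q : 𝒞,
    Function.Injective (fun g : Q ⟶ X.X 0 => g ≫ X.d 0) ∧
    ∀ i, i < n → Function.Exact
      (fun g : Q ⟶ X.X i => g ≫ X.d i) (fun g : Q ⟶ X.X (i + 1) => g ≫ X.d (i + 1))

/-- `n`-cokernel sequences: `0 ⟶ 𝒞(Xⁿ⁺¹, -) ⟶ 𝒞(Xⁿ, -) ⟶ ⋯ ⟶ 𝒞(X⁰, -)` is exact. -/
def Cplx.IsNCokernel {n : ℕ} (X : Cplx 𝒞 n) : Prop :=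
  ∀ Q : 𝒞,
    Function.Injective (fun g : X.X (n + 1) ⟶ Q => X.d n ≫ g) ∧
    ∀ i, i < n → Function.Exact
      (fun g : X.X (i + 2) ⟶ Q => X.d (i + 1) ≫ g) (fun g : X.X (i + 1) ⟶ Q => X.d i ≫ g)

/-- `n`-exact sequences. -/
def Cplx.IsNExact {n : ℕ} (X : Cplx 𝒞 n) : Prop := X.IsNKernel ∧ X.IsNCokernel

end Complexes

section Cones

variable {𝒞 : Type u} [Category.{v} 𝒞] [Preadditive 𝒞] [HasZeroObject 𝒞]
  [HasBinaryBiproducts 𝒞]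

open ZeroObject

/-! ### Mapping cones and cocones

The mapping cone of `f : X ⟶ Y` is
`X¹ ⟶ X² ⊞ Y¹ ⟶ ⋯ ⟶ Xⁿ⁺¹ ⊞ Yⁿ ⟶ Yⁿ⁺¹`, with differentials given by the matrices
`[-d_X, 0; f, d_Y]` (only the entries that make sense are kept in the first and last one). It
does not involve the components of `X`, `Y` and `f` in degree `0`.

Dually the mapping cocone is
`X⁰ ⟶ X¹ ⊞ Y⁰ ⟶ ⋯ ⟶ Xⁿ ⊞ Yⁿ⁻¹ ⟶ Yⁿ`, with differentials `[d_X, 0; f, -d_Y]`. It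
does not involve the components of `X`, `Y` and `f` in degree `n + 1`.

Both are written with the partial inclusions and projections of the summands in degree `i`. -/

namespace Cone

variable (n : ℕ) (X Y : ℕ → 𝒞)

/-- `X¹` in degree `0`, `Xⁱ⁺¹ ⊞ Yⁱ` in degree `1 ≤ i ≤ n`, `Yⁿ⁺¹` in degree `n + 1`. -/
def obj : ℕ → 𝒞
  | 0 => X 1
  | i + 1 => if i < n then X (i + 2) ⊞ Y (i + 1) else if i = n then Y (i + 1) else 0

lemma obj_mid {i : ℕ} (h : i < n) : obj n X Y (i + 1) = (X (i + 2) ⊞ Y (i + 1)) := by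
  simp [obj, h]

lemma obj_end {i : ℕ} (h : i = n) : obj n X Y (i + 1) = Y (i + 1) := by
  simp [obj, h]

lemma isZero_obj {i : ℕ} (h : n < i) : IsZero (obj n X Y (i + 1)) := by
  have : obj n X Y (i + 1) = 0 := by simp [obj, h.not_gt, h.ne']
  rw [this]
  exact isZero_zero 𝒞

/-- The projection to `Xⁱ⁺¹`, zero if that is not a summand. -/
def fst : ∀ i, obj n X Y i ⟶ X (i + 1)
  | 0 => 𝟙 (X 1)
  | i + 1 => if h : i < n then eqToHom (obj_mid n X Y h) ≫ biprod.fst else 0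

/-- The inclusion of `Xⁱ⁺¹`, zero if that is not a summand. -/
def inl : ∀ i, X (i + 1) ⟶ obj n X Y i
  | 0 => 𝟙 (X 1)
  | i + 1 => if h : i < n then biprod.inl ≫ eqToHom (obj_mid n X Y h).symm else 0

/-- The projection to `Yⁱ`, zero if that is not a summand. -/
def snd : ∀ i, obj n X Y i ⟶ Y i
  | 0 => 0
  | i + 1 => if h : i < n then eqToHom (obj_mid n X Y h) ≫ biprod.snd
      else if h' : i = n then eqToHom (obj_end n X Y h') else 0

/-- The inclusion of `Yⁱ`, zero if that is not a summand. -/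
def inr : ∀ i, Y i ⟶ obj n X Y i
  | 0 => 0
  | i + 1 => if h : i < n then biprod.inr ≫ eqToHom (obj_mid n X Y h).symm
      else if h' : i = n then eqToHom (obj_end n X Y h').symm else 0

variable {X Y : CochainComplex 𝒞 ℕ} (f : X ⟶ Y)

/-- The differential of the mapping cone. -/
def d (i : ℕ) : obj n X.X Y.X i ⟶ obj n X.X Y.X (i + 1) :=
  -(fst n X.X Y.X i ≫ X.d (i + 1) (i + 2) ≫ inl n X.X Y.X (i + 1)) +
    fst n X.X Y.X i ≫ f.f (i + 1) ≫ inr n X.X Y.X (i + 1) +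
    snd n X.X Y.X i ≫ Y.d i (i + 1) ≫ inr n X.X Y.X (i + 1)

lemma d_comp_d (i : ℕ) : d n f i ≫ d n f (i + 1) = 0 := by
  by_cases h : i < n
  · have h₁ : inl n X.X Y.X (i + 1) ≫ fst n X.X Y.X (i + 1) = 𝟙 _ := by simp [inl, fst, h]
    have h₂ : inl n X.X Y.X (i + 1) ≫ snd n X.X Y.X (i + 1) = 0 := by simp [inl, snd, h]
    have h₃ : inr n X.X Y.X (i + 1) ≫ fst n X.X Y.X (i + 1) = 0 := by simp [inr, fst, h]
    have h₄ : inr n X.X Y.X (i + 1) ≫ snd n X.X Y.X (i + 1) = 𝟙 _ := by simp [inr, snd, h]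
    simp [d, reassoc_of% h₁, reassoc_of% h₂, reassoc_of% h₃, reassoc_of% h₄]
  · exact (isZero_obj n X.X Y.X (by omega)).eq_of_tgt _ _

end Cone

namespace Cocone

variable (n : ℕ) (X Y : ℕ → 𝒞)

/-- `X⁰` in degree `0`, `Xⁱ ⊞ Yⁱ⁻¹` in degree `1 ≤ i ≤ n`, `Yⁿ` in degree `n + 1`. -/
def obj : ℕ → 𝒞
  | 0 => X 0
  | i + 1 => if i < n then X (i + 1) ⊞ Y i else if i = n then Y i else 0

lemma obj_mid {i : ℕ} (h : i < n) : obj n X Y (i + 1) = (X (i + 1) ⊞ Y i) := by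
  simp [obj, h]

lemma obj_end {i : ℕ} (h : i = n) : obj n X Y (i + 1) = Y i := by
  simp [obj, h]

lemma isZero_obj {i : ℕ} (h : n < i) : IsZero (obj n X Y (i + 1)) := by
  have : obj n X Y (i + 1) = 0 := by simp [obj, h.not_gt, h.ne']
  rw [this]
  exact isZero_zero 𝒞

/-- The projection to `Xⁱ`, zero if that is not a summand. -/
def fst : ∀ i, obj n X Y i ⟶ X i
  | 0 => 𝟙 (X 0)
  | i + 1 => if h : i < n then eqToHom (obj_mid n X Y h) ≫ biprod.fst else 0

/-- The inclusion of `Xⁱ`, zero if that is not a summand. -/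
def inl : ∀ i, X i ⟶ obj n X Y i
  | 0 => 𝟙 (X 0)
  | i + 1 => if h : i < n then biprod.inl ≫ eqToHom (obj_mid n X Y h).symm else 0

/-- The projection from degree `i + 1` to `Yⁱ`, zero if that is not a summand. -/
def snd (i : ℕ) : obj n X Y (i + 1) ⟶ Y i :=
  if h : i < n then eqToHom (obj_mid n X Y h) ≫ biprod.snd
  else if h' : i = n then eqToHom (obj_end n X Y h') else 0

/-- The inclusion of `Yⁱ` into degree `i + 1`, zero if that is not a summand. -/
def inr (i : ℕ) : Y i ⟶ obj n X Y (i + 1) :=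
  if h : i < n then biprod.inr ≫ eqToHom (obj_mid n X Y h).symm
  else if h' : i = n then eqToHom (obj_end n X Y h').symm else 0

variable {X Y : CochainComplex 𝒞 ℕ} (f : X ⟶ Y)

/-- The differential of the mapping cocone. -/
def d : ∀ i : ℕ, obj n X.X Y.X i ⟶ obj n X.X Y.X (i + 1)
  | 0 => fst n X.X Y.X 0 ≫ X.d 0 1 ≫ inl n X.X Y.X 1 +
      fst n X.X Y.X 0 ≫ f.f 0 ≫ inr n X.X Y.X 0
  | i + 1 => fst n X.X Y.X (i + 1) ≫ X.d (i + 1) (i + 2) ≫ inl n X.X Y.X (i + 2) +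
      fst n X.X Y.X (i + 1) ≫ f.f (i + 1) ≫ inr n X.X Y.X (i + 1) -
      snd n X.X Y.X i ≫ Y.d i (i + 1) ≫ inr n X.X Y.X (i + 1)

lemma d_comp_d (i : ℕ) : d n f i ≫ d n f (i + 1) = 0 := by
  by_cases h : i < n
  · have h₁ : inl n X.X Y.X (i + 1) ≫ fst n X.X Y.X (i + 1) = 𝟙 _ := by simp [inl, fst, h]
    have h₂ : inl n X.X Y.X (i + 1) ≫ snd n X.X Y.X i = 0 := by simp [inl, snd, h]
    have h₃ : inr n X.X Y.X i ≫ fst n X.X Y.X (i + 1) = 0 := by simp [inr, fst, h]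
    have h₄ : inr n X.X Y.X i ≫ snd n X.X Y.X i = 𝟙 _ := by simp [inr, snd, h]
    cases i with
    | zero =>
      simp [d, reassoc_of% h₁, reassoc_of% h₂, reassoc_of% h₃, reassoc_of% h₄]
    | succ i =>
      simp [d, reassoc_of% h₁, reassoc_of% h₂, reassoc_of% h₃, reassoc_of% h₄]
  · exact (isZero_obj n X.X Y.X (by omega)).eq_of_tgt _ _

end Cocone

/-- The mapping cone `X¹ ⟶ X² ⊞ Y¹ ⟶ ⋯ ⟶ Xⁿ⁺¹ ⊞ Yⁿ ⟶ Yⁿ⁺¹` of `f : X ⟶ Y`. -/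
def cone {n : ℕ} {X Y : Cplx 𝒞 n} (f : X.K ⟶ Y.K) : Cplx 𝒞 n where
  K := CochainComplex.of (Cone.obj n X.K.X Y.K.X) (Cone.d n f) (Cone.d_comp_d n f)
  isZero i hi := by
    obtain ⟨j, rfl⟩ : ∃ j, i = j + 1 := ⟨i - 1, by omega⟩
    exact Cone.isZero_obj n _ _ (by omega)

/-- The mapping cocone `X⁰ ⟶ X¹ ⊞ Y⁰ ⟶ ⋯ ⟶ Xⁿ ⊞ Yⁿ⁻¹ ⟶ Yⁿ` of `f : X ⟶ Y`. -/
def cocone {n : ℕ} {X Y : Cplx 𝒞 n} (f : X.K ⟶ Y.K) : Cplx 𝒞 n where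
  K := CochainComplex.of (Cocone.obj n X.K.X Y.K.X) (Cocone.d n f) (Cocone.d_comp_d n f)
  isZero i hi := by
    obtain ⟨j, rfl⟩ : ∃ j, i = j + 1 := ⟨i - 1, by omega⟩
    exact Cocone.isZero_obj n _ _ (by omega)

/-- The mapping cone, as a complex with end terms `X¹` and `Yⁿ⁺¹ = D`. -/
def coneEnds {n : ℕ} {A B C D : 𝒞} {X : Ends n A C} {Y : Ends n B D} (f : X.K ⟶ Y.K) :
    Ends n (X.X 1) D where
  toCplx := cone (X := X.toCplx) (Y := Y.toCplx) f
  h₀ := rfl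
  h₁ := (Cone.obj_end n X.K.X Y.K.X rfl).trans Y.h₁

/-- The mapping cocone, as a complex with end terms `X⁰ = A` and `Yⁿ`. -/
def coconeEnds {n : ℕ} {A B C D : 𝒞} {X : Ends n A C} {Y : Ends n B D} (f : X.K ⟶ Y.K) :
    Ends n A (Y.X n) where
  toCplx := cocone (X := X.toCplx) (Y := Y.toCplx) f
  h₀ := X.h₀
  h₁ := Cocone.obj_end n X.K.X Y.K.X rfl

/-! ### The complexes realizing `0 ∈ 𝔼(0, A)` and `0 ∈ 𝔼(A, 0)` -/

/-- The components `A, A, 0, 0, …`. -/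
def idLeftObj (A : 𝒞) : ℕ → 𝒞
  | 0 => A
  | 1 => A
  | _ + 2 => 0

/-- The differentials `𝟙, 0, 0, …`. -/
def idLeftD (A : 𝒞) : ∀ i, idLeftObj A i ⟶ idLeftObj A (i + 1)
  | 0 => 𝟙 A
  | _ + 1 => 0

/-- `A ⟶ A ⟶ 0 ⟶ ⋯ ⟶ 0`, the first morphism being the identity. -/
def idLeft {n : ℕ} (hn : 0 < n) (A : 𝒞) : Ends n A (0 : 𝒞) where
  K := CochainComplex.of (idLeftObj A) (idLeftD A)
    (fun i => by cases i <;> exact comp_zero)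
  isZero i hi := by
    obtain ⟨j, rfl⟩ : ∃ j, i = j + 2 := ⟨i - 2, by omega⟩
    exact isZero_zero 𝒞
  h₀ := rfl
  h₁ := by
    obtain ⟨j, rfl⟩ : ∃ j, n = j + 1 := ⟨n - 1, by omega⟩
    rfl

/-- The components `A` in degrees `n` and `n + 1`, and `0` in the other degrees. -/
def idRightObj (n : ℕ) (A : 𝒞) (i : ℕ) : 𝒞 := if i = n ∨ i = n + 1 then A else 0

/-- `0 ⟶ ⋯ ⟶ 0 ⟶ A ⟶ A`, the last morphism being the identity. -/
def idRight {n : ℕ} (hn : 0 < n) (A : 𝒞) : Ends n (0 : 𝒞) A where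
  K := CochainComplex.of (idRightObj n A)
    (fun i => if h : i = n then eqToHom (by simp [idRightObj, h]) else 0)
    (fun i => by
      by_cases h : i = n
      · simp [h]
      · simp [h])
  isZero i hi := by
    change IsZero (idRightObj n A i)
    rw [idRightObj, if_neg (by omega)]
    exact isZero_zero 𝒞
  h₀ := by
    change idRightObj n A 0 = 0
    rw [idRightObj, if_neg (by omega)]
  h₁ := by
    change idRightObj n A (n + 1) = A
    rw [idRightObj, if_pos (by omega)]

end Cones

/-! ### Extensions and realizations -/

section Extensions

variable {𝒞 : Type u} [Category.{v} 𝒞] [Preadditive 𝒞]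

/-- The group `𝔼(C, A)` of extensions. -/
abbrev Ext (E : 𝒞ᵒᵖ ⥤ 𝒞 ⥤ AddCommGrpCat.{w}) (C A : 𝒞) : Type w :=
  (E.obj (Opposite.op C)).obj A

variable {E : 𝒞ᵒᵖ ⥤ 𝒞 ⥤ AddCommGrpCat.{w}}

/-- `a_* δ`. -/
def push {A A' C : 𝒞} (a : A ⟶ A') (δ : Ext E C A) : Ext E C A' :=
  (E.obj (Opposite.op C)).map a δ

/-- `c^* δ`. -/
def pull {A C C' : 𝒞} (c : C' ⟶ C) (δ : Ext E C A) : Ext E C' A :=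
  (E.map c.op).app A δ

/-- The pair `⟨X, δ⟩` is an `n`-exangle: for every object `Q` the sequences
`𝒞(Q, X⁰) ⟶ ⋯ ⟶ 𝒞(Q, Xⁿ⁺¹) ⟶ 𝔼(Q, X⁰)` and
`𝒞(Xⁿ⁺¹, Q) ⟶ ⋯ ⟶ 𝒞(X⁰, Q) ⟶ 𝔼(Xⁿ⁺¹, Q)` are exact. -/
def IsNExangle {n : ℕ} (X : Cplx 𝒞 n) (δ : Ext E (X.X (n + 1)) (X.X 0)) : Prop :=
  (∀ Q : 𝒞,
    (∀ i, i < n → Function.Exact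
      (fun g : Q ⟶ X.X i => g ≫ X.d i) (fun g : Q ⟶ X.X (i + 1) => g ≫ X.d (i + 1))) ∧
    Function.Exact
      (fun g : Q ⟶ X.X n => g ≫ X.d n) (fun g : Q ⟶ X.X (n + 1) => pull g δ)) ∧
  (∀ Q : 𝒞,
    (∀ i, i < n → Function.Exact
      (fun g : X.X (i + 2) ⟶ Q => X.d (i + 1) ≫ g) (fun g : X.X (i + 1) ⟶ Q => X.d i ≫ g)) ∧
    Function.Exact
      (fun g : X.X 1 ⟶ Q => X.d 0 ≫ g) (fun g : X.X 0 ⟶ Q => push g δ))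

/-- A correspondence which associates to each extension `δ ∈ 𝔼(C, A)` a homotopic equivalence
class of complexes with end terms `A` and `C`. -/
structure Correspondence (E : 𝒞ᵒᵖ ⥤ 𝒞 ⥤ AddCommGrpCat.{w}) (n : ℕ) where
  /-- The homotopic equivalence class `s(δ)`. -/
  real : ∀ {A C : 𝒞}, Ext E C A → HtpyClass n A C

/-- The class of conflations: the complexes `X` that realize some extension in
`𝔼(Xⁿ⁺¹, X⁰)`. -/
def conflations {n : ℕ} (s : Correspondence E n) : Set (Cplx 𝒞 n) :=
  {X | ∃ δ : Ext E (X.X (n + 1)) (X.X 0), s.real δ = X.ends.cls}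

end Extensions

section Structures

variable {𝒞 : Type u} [Category.{v} 𝒞] [Preadditive 𝒞]

/-- The morphisms that occur as the first differential `X⁰ ⟶ X¹` of some `X ∈ 𝒳`: inflations
if `𝒳` is the class of conflations, `𝒳`-admissible monomorphisms in general. -/
def firstMaps {n : ℕ} (𝒳 : Set (Cplx 𝒞 n)) : MorphismProperty 𝒞 :=
  MorphismProperty.ofHoms (fun X : 𝒳 => X.1.d 0)

/-- The morphisms that occur as the last differential `Xⁿ ⟶ Xⁿ⁺¹` of some `X ∈ 𝒳`: deflations
if `𝒳` is the class of conflations, `𝒳`-admissible epimorphisms in general. -/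
def lastMaps {n : ℕ} (𝒳 : Set (Cplx 𝒞 n)) : MorphismProperty 𝒞 :=
  MorphismProperty.ofHoms (fun X : 𝒳 => X.1.d n)

variable [HasZeroObject 𝒞] [HasBinaryBiproducts 𝒞]

open ZeroObject

/-- `s` is an exact realization of `E`. -/
structure IsExactRealization {n : ℕ} (hn : 0 < n) {E : 𝒞ᵒᵖ ⥤ 𝒞 ⥤ AddCommGrpCat.{w}}
    (s : Correspondence E n) : Prop where
  /-- (R0): every morphism `(a, c)` of extensions has a lift. -/
  r0 : ∀ {A B C D : 𝒞} (δ : Ext E C A) (ρ : Ext E D B) (X : Ends n A C) (Y : Ends n B D),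
    s.real δ = X.cls → s.real ρ = Y.cls → ∀ (a : A ⟶ B) (c : C ⟶ D), push a δ = pull c ρ →
      ∃ f : X.K ⟶ Y.K, left (X := X) (Y := Y) f = a ∧ right (X := X) (Y := Y) f = c
  /-- (R1) -/
  r1 : ∀ (X : Cplx 𝒞 n) (δ : Ext E (X.X (n + 1)) (X.X 0)),
    s.real δ = X.ends.cls → IsNExangle X δ
  /-- (R2) -/
  r2 : ∀ A : 𝒞, s.real (0 : Ext E (0 : 𝒞) A) = (idLeft hn A).cls
  /-- (R2), dual part -/
  r2_op : ∀ A : 𝒞, s.real (0 : Ext E A (0 : 𝒞)) = (idRight hn A).cls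

/-- `(𝒞, E, s)` is an `n`-exangulated category (for an additive category `𝒞` and a biadditive
functor `E`). -/
structure IsNExangulated {n : ℕ} (hn : 0 < n) (E : 𝒞ᵒᵖ ⥤ 𝒞 ⥤ AddCommGrpCat.{w})
    (s : Correspondence E n) : Prop where
  exactRealization : IsExactRealization hn s
  /-- (EA1): inflations are closed by composition. -/
  ea1 : (firstMaps (conflations s)).IsStableUnderComposition
  /-- (EA1), dual part: deflations are closed by composition. -/
  ea1_op : (lastMaps (conflations s)).IsStableUnderComposition
  /-- (EA2): `(𝟙, c)` has a good lift. -/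
  ea2 : ∀ {A C D : 𝒞} (ρ : Ext E D A) (c : C ⟶ D) (X : Ends n A C) (Y : Ends n A D),
    s.real (pull c ρ) = X.cls → s.real ρ = Y.cls →
      ∃ f : X.K ⟶ Y.K, left (X := X) (Y := Y) f = 𝟙 A ∧ right (X := X) (Y := Y) f = c ∧
        s.real (push X.first ρ) = (coneEnds (X := X) (Y := Y) f).cls
  /-- (EA2ᵒᵖ): `(a, 𝟙)` has a good lift. -/
  ea2_op : ∀ {A B C : 𝒞} (δ : Ext E C A) (a : A ⟶ B) (X : Ends n A C) (Y : Ends n B C),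
    s.real δ = X.cls → s.real (push a δ) = Y.cls →
      ∃ f : X.K ⟶ Y.K, left (X := X) (Y := Y) f = a ∧ right (X := X) (Y := Y) f = 𝟙 C ∧
        s.real (pull Y.last δ) = (coconeEnds (X := X) (Y := Y) f).cls

/-! ### Conditions on a class of complexes -/

variable {n : ℕ} (𝒳 : Set (Cplx 𝒞 n))

/-- (EC′): the members of `𝒳` with given end terms are closed by homotopic equivalences that
fix the end terms. -/
def ECprime : Prop :=
  ∀ {A C : 𝒞} (X Y : Ends n A C), X.cls = Y.cls → X.toCplx ∈ 𝒳 → Y.toCplx ∈ 𝒳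

/-- (E0): the sequence `0 ⟶ 0 ⟶ ⋯ ⟶ 0` belongs to `𝒳`, whatever zero objects are used. -/
def E0 : Prop := ∀ X : Cplx 𝒞 n, (∀ i, IsZero (X.X i)) → X ∈ 𝒳

/-- (E1): `𝒳`-admissible monomorphisms are closed by composition. -/
def E1 : Prop := (firstMaps 𝒳).IsStableUnderComposition

/-- (E1ᵒᵖ): `𝒳`-admissible epimorphisms are closed by composition. -/
def E1op : Prop := (lastMaps 𝒳).IsStableUnderComposition

/-- (E2′) -/
def E2prime : Prop :=
  (∀ {A A' C : 𝒞} (a : A ⟶ A') (X : Ends n A C), X.toCplx ∈ 𝒳 →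
    ∃ Y : Ends n A' C, Y.toCplx ∈ 𝒳 ∧ ∃ f : X.K ⟶ Y.K,
      left (X := X) (Y := Y) f = a ∧ right (X := X) (Y := Y) f = 𝟙 C) ∧
  (∀ {A A' C : 𝒞} (X : Ends n A C) (Y : Ends n A' C), X.toCplx ∈ 𝒳 → Y.toCplx ∈ 𝒳 →
    ∀ f : X.K ⟶ Y.K, right (X := X) (Y := Y) f = 𝟙 C →
      cocone (X := X.toCplx) (Y := Y.toCplx) f ∈ 𝒳)

/-- (E2′ᵒᵖ) -/
def E2primeOp : Prop :=
  (∀ {A C C' : 𝒞} (c : C' ⟶ C) (Y : Ends n A C), Y.toCplx ∈ 𝒳 →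
    ∃ X : Ends n A C', X.toCplx ∈ 𝒳 ∧ ∃ f : X.K ⟶ Y.K,
      left (X := X) (Y := Y) f = 𝟙 A ∧ right (X := X) (Y := Y) f = c) ∧
  (∀ {A C C' : 𝒞} (X : Ends n A C') (Y : Ends n A C), X.toCplx ∈ 𝒳 → Y.toCplx ∈ 𝒳 →
    ∀ f : X.K ⟶ Y.K, left (X := X) (Y := Y) f = 𝟙 A →
      cone (X := X.toCplx) (Y := Y.toCplx) f ∈ 𝒳)

/-- (EI): for `X ∈ 𝒳` the class `[X]` is isolated among the classes of `n`-exact sequences with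
the same end terms, ordered by existence of a morphism that is the identity on the end terms. -/
def EI : Prop :=
  ∀ {A C : 𝒞} (X X' : Ends n A C), X.toCplx ∈ 𝒳 → X'.toCplx.IsNExact →
    ((∃ f : X.K ⟶ X'.K, IsEndsHom (X := X) (Y := X') f) ∨
      (∃ f : X'.K ⟶ X.K, IsEndsHom (X := X') (Y := X) f)) →
    X.cls = X'.cls

/-- The part in degrees `1, …, n + 1` of `f : X ⟶ Y` is an `n`-pullback diagram. (The mapping
cone does not depend on the components in degree `0`.) -/
def IsNPullback {X Y : Cplx 𝒞 n} (f : X.K ⟶ Y.K) : Prop := (cone (X := X) (Y := Y) f).IsNKernel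

/-- The part in degrees `0, …, n` of `f : X ⟶ Y` is an `n`-pushout diagram. (The mapping
cocone does not depend on the components in degree `n + 1`.) -/
def IsNPushout {X Y : Cplx 𝒞 n} (f : X.K ⟶ Y.K) : Prop :=
  (cocone (X := X) (Y := Y) f).IsNCokernel

/-- `(𝒞, 𝒳)` is an `n`-exact category (for an additive category `𝒞`).

In (E2) and (E2ᵒᵖ) only the components in degrees `≤ n`, respectively `≥ 1`, of the diagram
matter. A commutative diagram in these degrees extends to a morphism of complexes, for instance
by `Yⁿ⁺¹ = 0`, respectively `X⁰ = 0`. -/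
structure IsNExactCategory : Prop where
  /-- All members of `𝒳` are `n`-exact sequences. -/
  isNExact : ∀ X ∈ 𝒳, X.IsNExact
  /-- (EC)(i) -/
  ec_i : ∀ (X Y : Cplx 𝒞 n), X.IsNExact → Y.IsNExact → ∀ (f : X.K ⟶ Y.K) (k : ℕ), k ≤ n →
    IsIso (f.f k) → IsIso (f.f (k + 1)) → (X ∈ 𝒳 ↔ Y ∈ 𝒳)
  /-- (EC)(ii) -/
  ec_ii : ∀ (X Y : Cplx 𝒞 n), X.IsNExact → Y.IsNExact → ∀ f : X.K ⟶ Y.K,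
    IsIso (f.f 0) → IsIso (f.f (n + 1)) → (X ∈ 𝒳 ↔ Y ∈ 𝒳)
  e0 : E0 𝒳
  e1 : E1 𝒳
  e1_op : E1op 𝒳
  /-- (E2): `n`-pushouts of members of `𝒳` exist, and the first morphism of the lower row is an
  `𝒳`-admissible monomorphism. -/
  e2 : ∀ X ∈ 𝒳, ∀ (B : 𝒞) (b : X.X 0 ⟶ B),
    ∃ (Y : Cplx 𝒞 n) (h : Y.X 0 = B) (f : X.K ⟶ Y.K),
      f.f 0 ≫ eqToHom h = b ∧ IsNPushout (X := X) (Y := Y) f ∧ firstMaps 𝒳 (Y.d 0)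
  /-- (E2ᵒᵖ): `n`-pullbacks of members of `𝒳` exist, and the last morphism of the upper row is
  an `𝒳`-admissible epimorphism. -/
  e2_op : ∀ Y ∈ 𝒳, ∀ (D : 𝒞) (c : D ⟶ Y.X (n + 1)),
    ∃ (X : Cplx 𝒞 n) (h : X.X (n + 1) = D) (f : X.K ⟶ Y.K),
      eqToHom h.symm ≫ f.f (n + 1) = c ∧ IsNPullback (X := X) (Y := Y) f ∧ lastMaps 𝒳 (X.d n)

end Structures

end

end NExangulated

namespace NExangulated

universe w v u

noncomputable section

/-! ### Comparison of complexes: extending morphisms and homotopies degree by degree -/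

section Comparison

variable {𝒞 : Type u} [Category.{v} 𝒞] [Preadditive 𝒞] {n : ℕ}

/-! (R1) gives all of `n`-exactness except injectivity at the two outer places, and that is what
"inflations are mono, deflations are epi" supplies. So conflations are `n`-exact, and the usual
comparison arguments apply: a commutative square in adjacent degrees extends to a morphism of
complexes, and a morphism vanishing at one end is null-homotopic.

The heart of the first part is `push_left_eq_pull_right`: any morphism of conflations, with end
components `a` and `c`, satisfies `a_* δ = c^* ρ`. The difference of the two sides dies under the
first differential of the target, hence has the form `b^* ρ` by the exactness proved in
`exists_eq_pull`. A lift of `(a, b + c)` given by (R0) then differs from the given morphism by one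
that vanishes on the left, so `b` factors through the last differential of the target and `b^* ρ =
0`. For (E2′) and its dual, the given morphism is therefore homotopic to the good lift of (EA2ᵒᵖ) or
(EA2), and homotopies vanishing at the relevant end give isomorphic cocones or cones.

For the second part, an `n`-exact `Y` starting with an inflation receives a morphism, identical on
the ends, from a conflation `V`. The last differential of `V` factors through that of `Y`, so (b)
makes the latter a deflation. Then `Y` also maps to a conflation `W`. The composite `V ⟶ W` forces
`V` and `W` to realize the same extension, and (R0) closes the circle to a homotopy equivalence
between `V` and `Y`. Thus one admissible end suffices for being a conflation (`mem_of_first`,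
`mem_of_last`). (EI) and (EC) reduce to finding such an end. -/

lemma extend_left {X Y : Cplx 𝒞 n} (hY : Y.IsNKernel) (k : ℕ) (hk : k ≤ n)
    (φ : ∀ i, X.X i ⟶ Y.X i) (hφ : φ k ≫ Y.d k = X.d k ≫ φ (k + 1)) :
    ∃ ψ : ∀ i, X.X i ⟶ Y.X i, (∀ i, k ≤ i → ψ i = φ i) ∧
      ∀ i, i ≤ k → ψ i ≫ Y.d i = X.d i ≫ ψ (i + 1) := by
  induction k generalizing φ with
  | zero =>
    refine ⟨φ, fun _ _ => rfl, fun i hi => ?_⟩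
    obtain rfl : i = 0 := by omega
    exact hφ
  | succ k ih =>
    obtain ⟨x, hx⟩ := (((hY (X.X k)).2 k (by omega)) (X.d k ≫ φ (k + 1))).1 (by
      simp [hφ])
    have hx : x ≫ Y.d k = X.d k ≫ φ (k + 1) := hx
    obtain ⟨ψ, h₁, h₂⟩ := ih (by omega) (Function.update φ k x) (by
      rw [Function.update_self, Function.update_of_ne (by omega), hx])
    have h₃ : ∀ i, k + 1 ≤ i → ψ i = φ i := fun i hi => by
      rw [h₁ i (by omega), Function.update_of_ne (by omega)]
    refine ⟨ψ, h₃, fun i hi => ?_⟩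
    obtain hi | rfl : i ≤ k ∨ i = k + 1 := by omega
    · exact h₂ i hi
    · rw [h₃ _ le_rfl, h₃ _ (by omega), hφ]

/-- Upward induction: the next component exists by exactness of `𝒞(X, -)`, and beyond degree `n + 1`
commutativity is automatic because the target is zero. -/
lemma extend_right {X Y : Cplx 𝒞 n} (hX : X.IsNCokernel) (k : ℕ)
    (φ : ∀ i, X.X i ⟶ Y.X i) (hφ : ∀ i, i ≤ k → φ i ≫ Y.d i = X.d i ≫ φ (i + 1)) (m : ℕ) :
    ∃ ψ : ∀ i, X.X i ⟶ Y.X i, (∀ i, i ≤ k + 1 → ψ i = φ i) ∧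
      ∀ i, i ≤ k + m → ψ i ≫ Y.d i = X.d i ≫ ψ (i + 1) := by
  induction m with
  | zero => exact ⟨φ, fun _ _ => rfl, hφ⟩
  | succ m ih =>
    obtain ⟨ψ, h₁, h₂⟩ := ih
    by_cases h : k + m < n
    · obtain ⟨x, hx⟩ := (((hX (Y.X (k + m + 2))).2 (k + m) h) (ψ (k + m + 1) ≫ Y.d (k + m + 1))).1
        (by simp [← reassoc_of% (h₂ (k + m) le_rfl)])
      have hx : X.d (k + m + 1) ≫ x = ψ (k + m + 1) ≫ Y.d (k + m + 1) := hx
      refine ⟨Function.update ψ (k + m + 2) x, fun i hi => ?_, fun i hi => ?_⟩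
      · rw [Function.update_of_ne (by omega), h₁ i hi]
      · obtain hi | rfl : i ≤ k + m ∨ i = k + m + 1 := by omega
        · rw [Function.update_of_ne (by omega), Function.update_of_ne (by omega), h₂ i hi]
        · rw [Function.update_of_ne (by omega), Function.update_self, hx]
    · refine ⟨ψ, h₁, fun i hi => ?_⟩
      obtain hi | rfl : i ≤ k + m ∨ i = k + m + 1 := by omega
      · exact h₂ i hi
      · exact (Y.isZero _ (by omega)).eq_of_tgt _ _

/-- A commutative square in degrees `k`, `k + 1` extends to a morphism from an `n`-cokernel
sequence to an `n`-kernel sequence. -/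
lemma exists_hom {X Y : Cplx 𝒞 n} (hX : X.IsNCokernel) (hY : Y.IsNKernel) (k : ℕ) (hk : k ≤ n)
    (a : X.X k ⟶ Y.X k) (b : X.X (k + 1) ⟶ Y.X (k + 1)) (h : a ≫ Y.d k = X.d k ≫ b) :
    ∃ f : X.K ⟶ Y.K, f.f k = a ∧ f.f (k + 1) = b := by
  -- The zeros outside degrees `k` and `k + 1` are placeholders that the two extensions overwrite.
  let φ : ∀ i, X.X i ⟶ Y.X i := Function.update (Function.update 0 k a) (k + 1) b
  have h₀ : φ k = a := by
    simp only [φ]; rw [Function.update_of_ne (by omega), Function.update_self]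
  have h₁ : φ (k + 1) = b := Function.update_self ..
  obtain ⟨ψ, hψ, hψ'⟩ := extend_left hY k hk φ (by rw [h₀, h₁, h])
  obtain ⟨χ, hχ, hχ'⟩ := extend_right hX k ψ hψ' (n + 1)
  refine ⟨{ f := χ, comm' := ?_ }, ?_, ?_⟩
  · rintro i _ rfl
    by_cases hi : i ≤ k + (n + 1)
    · exact hχ' i hi
    · exact (Y.isZero _ (by omega)).eq_of_tgt _ _
  · exact (hχ k (by omega)).trans ((hψ k le_rfl).trans h₀)
  · exact (hχ _ le_rfl).trans ((hψ _ (by omega)).trans h₁)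

/-- `H` is a homotopy from `u` to `0`. -/
def IsNullHtpy {X Y : CochainComplex 𝒞 ℕ} (u : X ⟶ Y) (H : ∀ i, X.X (i + 1) ⟶ Y.X i) : Prop :=
  u.f 0 = X.d 0 1 ≫ H 0 ∧
    ∀ i, u.f (i + 1) = H i ≫ Y.d i (i + 1) + X.d (i + 1) (i + 2) ≫ H (i + 1)

/-- A homotopy satisfying its equation in one degree propagates downwards, since `u - dH` is killed
by the next differential of `Y`. In degree `0` nothing is left to choose: the equation follows on
cancelling the monomorphism `Y.d 0`. -/
lemma htpy_left {X Y : Cplx 𝒞 n} (hY : Y.IsNKernel) (u : X.K ⟶ Y.K) (k : ℕ) (hk : k ≤ n)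
    (H : ∀ i, X.X (i + 1) ⟶ Y.X i)
    (hH : u.f (k + 1) = H k ≫ Y.d k + X.d (k + 1) ≫ H (k + 1)) :
    ∃ H' : ∀ i, X.X (i + 1) ⟶ Y.X i, (∀ i, k ≤ i → H' i = H i) ∧
      u.f 0 = X.d 0 ≫ H' 0 ∧
      ∀ i, i ≤ k → u.f (i + 1) = H' i ≫ Y.d i + X.d (i + 1) ≫ H' (i + 1) := by
  induction k generalizing H with
  | zero =>
    refine ⟨H, fun _ _ => rfl, (hY _).1 ?_, fun i hi => ?_⟩
    · have : X.d 0 ≫ u.f 1 = X.d 0 ≫ H 0 ≫ Y.d 0 := by simp [hH]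
      simpa using this
    · obtain rfl : i = 0 := by omega
      exact hH
  | succ k ih =>
    obtain ⟨x, hx⟩ := (((hY (X.X (k + 1))).2 k (by omega))
      (u.f (k + 1) - X.d (k + 1) ≫ H (k + 1))).1 (by simp [hH])
    have hx : x ≫ Y.d k = u.f (k + 1) - X.d (k + 1) ≫ H (k + 1) := hx
    obtain ⟨ψ, h₁, h₀, h₂⟩ := ih (by omega) (Function.update H k x) (by
      rw [Function.update_self, Function.update_of_ne (by omega), hx]; abel)
    have h₃ : ∀ i, k + 1 ≤ i → ψ i = H i := fun i hi => by
      rw [h₁ i (by omega), Function.update_of_ne (by omega)]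
    refine ⟨ψ, h₃, h₀, fun i hi => ?_⟩
    obtain hi | rfl : i ≤ k ∨ i = k + 1 := by omega
    · exact h₂ i hi
    · rw [h₃ _ le_rfl, h₃ _ (by omega), hH]

/-- Upward construction of a homotopy; in degree `n + 1` no further component is available, and
cancelling the epimorphism `X.d n` gives the equation. -/
lemma htpy_right {X Y : Cplx 𝒞 n} (hX : X.IsNCokernel) (u : X.K ⟶ Y.K) (hu : u.f 0 = 0) (m : ℕ) :
    ∃ H : ∀ i, X.X (i + 1) ⟶ Y.X i, H 0 = 0 ∧
      ∀ i, i < m → u.f (i + 1) = H i ≫ Y.d i + X.d (i + 1) ≫ H (i + 1) := by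
  induction m with
  | zero => exact ⟨fun _ => 0, rfl, fun i hi => by omega⟩
  | succ m ih =>
    obtain ⟨H, h₀, h₁⟩ := ih
    have key : X.d m ≫ (u.f (m + 1) - H m ≫ Y.d m) = 0 := by
      have : u.f m ≫ Y.d m = X.d m ≫ H m ≫ Y.d m := by
        cases m with
        | zero => simp [hu, h₀]
        | succ m => simp [h₁ m (by omega)]
      rw [Preadditive.comp_sub, ← this]
      simp
    obtain h | rfl | h := lt_trichotomy m n
    · obtain ⟨x, hx⟩ := (((hX (Y.X (m + 1))).2 m h) (u.f (m + 1) - H m ≫ Y.d m)).1 key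
      have hx : X.d (m + 1) ≫ x = u.f (m + 1) - H m ≫ Y.d m := hx
      refine ⟨Function.update H (m + 1) x, ?_, fun i hi => ?_⟩
      · rw [Function.update_of_ne (by omega), h₀]
      · obtain hi | rfl : i < m ∨ i = m := by omega
        · rw [Function.update_of_ne (by omega), Function.update_of_ne (by omega), h₁ i hi]
        · rw [Function.update_of_ne (by omega), Function.update_self, hx]; abel
    · refine ⟨H, h₀, fun i hi => ?_⟩
      obtain hi | rfl : i < m ∨ i = m := by omega
      · exact h₁ i hi
      · have := (hX _).1 (key.trans comp_zero.symm)
        rw [(X.isZero (i + 2) (by omega)).eq_of_src (H (i + 1)) 0, comp_zero, add_zero]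
        exact sub_eq_zero.1 this
    · refine ⟨H, h₀, fun i hi => ?_⟩
      obtain hi | rfl : i < m ∨ i = m := by omega
      · exact h₁ i hi
      · exact (Y.isZero (i + 1) (by omega)).eq_of_tgt _ _

/-- The extra property `H 0 = 0` is what mapping cones need, as they have no summand `Y⁰`. Its
counterpart for cocones is `H n = 0` in `exists_htpy_of_right`. -/
lemma exists_htpy_of_left {X Y : Cplx 𝒞 n} (hX : X.IsNCokernel) (u : X.K ⟶ Y.K)
    (hu : u.f 0 = 0) : ∃ H, IsNullHtpy u H ∧ H 0 = 0 := by
  obtain ⟨H, h₀, h₁⟩ := htpy_right hX u hu (n + 1)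
  refine ⟨H, ⟨by rw [hu, h₀, comp_zero], fun i => ?_⟩, h₀⟩
  by_cases hi : i < n + 1
  · exact h₁ i hi
  · exact (Y.isZero (i + 1) (by omega)).eq_of_tgt _ _

lemma exists_htpy_of_right {X Y : Cplx 𝒞 n} (hY : Y.IsNKernel) (u : X.K ⟶ Y.K)
    (hu : u.f (n + 1) = 0) : ∃ H, IsNullHtpy u H ∧ H n = 0 := by
  obtain ⟨H, h, h₀, h₁⟩ := htpy_left hY u n le_rfl (fun _ => 0) (by simp [hu])
  refine ⟨H, ⟨h₀, fun i => ?_⟩, h n le_rfl⟩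
  by_cases hi : i ≤ n
  · exact h₁ i hi
  · exact (Y.isZero (i + 1) (by omega)).eq_of_tgt _ _

/-- A morphism to an `n`-kernel sequence which vanishes in one degree factors through the
differential in degree `0`. -/
lemma exists_factor_zero {X Y : Cplx 𝒞 n} (hY : Y.IsNKernel) (u : X.K ⟶ Y.K) (k : ℕ)
    (hk : k ≤ n) (hu : u.f k = 0) : ∃ h : X.X 1 ⟶ Y.X 0, u.f 0 = X.d 0 ≫ h := by
  cases k with
  | zero => exact ⟨0, by rw [hu, comp_zero]⟩
  | succ k =>
    obtain ⟨H, -, h₀, -⟩ := htpy_left hY u k (by omega) (fun _ => 0) (by simp [hu])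
    exact ⟨H 0, h₀⟩

lemma IsNullHtpy.neg {X Y : CochainComplex 𝒞 ℕ} {u : X ⟶ Y} {H : ∀ i, X.X (i + 1) ⟶ Y.X i}
    (h : IsNullHtpy u H) : IsNullHtpy (-u) (fun i => -H i) :=
  ⟨by simp [h.1], fun i => by simp [h.2 i]; abel⟩

/-- The homotopy in the sense of Mathlib. -/
def IsNullHtpy.homotopy {X Y : CochainComplex 𝒞 ℕ} {f g : X ⟶ Y}
    {H : ∀ i, X.X (i + 1) ⟶ Y.X i} (h : IsNullHtpy (f - g) H) : Homotopy f g where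
  hom i j := if hij : j + 1 = i then eqToHom (by rw [hij]) ≫ H j else 0
  zero i j hij := dif_neg (fun h => hij h)
  comm i := by
    cases i with
    | zero =>
      have := h.1
      rw [HomologicalComplex.sub_f_apply, sub_eq_iff_eq_add] at this
      rw [Homotopy.dNext_cochainComplex, Homotopy.prevD_zero_cochainComplex, this]
      simp
    | succ i =>
      have := h.2 i
      rw [HomologicalComplex.sub_f_apply, sub_eq_iff_eq_add] at this
      rw [Homotopy.dNext_cochainComplex, Homotopy.prevD_succ_cochainComplex, this]
      simp [add_comm]

/-- The morphism `dh + hd`. -/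
def htpyMap {X Y : CochainComplex 𝒞 ℕ} (H : ∀ i, X.X (i + 1) ⟶ Y.X i) : X ⟶ Y where
  f
    | 0 => X.d 0 1 ≫ H 0
    | i + 1 => H i ≫ Y.d i (i + 1) + X.d (i + 1) (i + 2) ≫ H (i + 1)
  comm' := by
    rintro i _ rfl
    cases i with
    | zero => simp
    | succ i => simp; rfl

end Comparison

/-! ### Complexes with fixed end terms -/

section Ends

variable {𝒞 : Type u} [Category.{v} 𝒞] [Preadditive 𝒞] {n : ℕ} {A B C D A' C' : 𝒞}

lemma left_comp {X : Ends n A A'} {Y : Ends n B D} {Z : Ends n C C'} (f : X.K ⟶ Y.K)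
    (g : Y.K ⟶ Z.K) : left (X := X) (Y := Z) (f ≫ g) =
      left (X := X) (Y := Y) f ≫ left (X := Y) (Y := Z) g := by
  simp [left]

lemma right_comp {X : Ends n A A'} {Y : Ends n B D} {Z : Ends n C C'} (f : X.K ⟶ Y.K)
    (g : Y.K ⟶ Z.K) : right (X := X) (Y := Z) (f ≫ g) =
      right (X := X) (Y := Y) f ≫ right (X := Y) (Y := Z) g := by
  simp [right]

lemma left_sub {X : Ends n A C} {Y : Ends n B D} (f g : X.K ⟶ Y.K) :
    left (X := X) (Y := Y) (f - g) = left (X := X) (Y := Y) f - left (X := X) (Y := Y) g := by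
  simp [left]

lemma right_sub {X : Ends n A C} {Y : Ends n B D} (f g : X.K ⟶ Y.K) :
    right (X := X) (Y := Y) (f - g) = right (X := X) (Y := Y) f - right (X := X) (Y := Y) g := by
  simp [right]

lemma f_eq_left {X : Ends n A C} {Y : Ends n B D} (f : X.K ⟶ Y.K) :
    f.f 0 = eqToHom X.h₀ ≫ left (X := X) (Y := Y) f ≫ eqToHom Y.h₀.symm := by
  simp [left]

lemma f_eq_right {X : Ends n A C} {Y : Ends n B D} (f : X.K ⟶ Y.K) :
    f.f (n + 1) = eqToHom X.h₁ ≫ right (X := X) (Y := Y) f ≫ eqToHom Y.h₁.symm := by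
  simp [right]

lemma left_comp_first {X : Ends n A C} {Y : Ends n B D} (f : X.K ⟶ Y.K) :
    left (X := X) (Y := Y) f ≫ Y.first = X.first ≫ f.f 1 := by
  simp [left, Ends.first]

lemma last_comp_right {X : Ends n A C} {Y : Ends n B D} (f : X.K ⟶ Y.K) :
    X.last ≫ right (X := X) (Y := Y) f = f.f n ≫ Y.last := by
  simp [right, Ends.last]

/-- A homotopy starting in degree `n + 1` only changes the right end. -/
lemma exists_right_correction (hn : 0 < n) (X : Ends n A C) (Y : Ends n B D) (h : C ⟶ Y.X n) :
    ∃ z : X.K ⟶ Y.K, left (X := X) (Y := Y) z = 0 ∧ right (X := X) (Y := Y) z = h ≫ Y.last := by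
  let H : ∀ i, X.X (i + 1) ⟶ Y.X i := fun i =>
    if hi : i = n then eqToHom (by subst hi; exact X.h₁) ≫ h ≫ eqToHom (by rw [hi]) else 0
  -- This is where `0 < n` enters: degrees `0` and `n` differ, so the left end is untouched.
  have h₀ : H 0 = 0 := dif_neg hn.ne
  have h₁ : H n = eqToHom X.h₁ ≫ h := by simp [H]
  have h₂ : H (n + 1) = 0 := dif_neg (by omega)
  exact ⟨htpyMap H, by simp [left, htpyMap, h₀], by simp [right, htpyMap, h₁, h₂, Ends.last]⟩

/-- A homotopy starting in degree `1` only changes the left end. -/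
lemma exists_left_correction (hn : 0 < n) (X : Ends n A C) (Y : Ends n B D) (h : X.X 1 ⟶ B) :
    ∃ z : X.K ⟶ Y.K, left (X := X) (Y := Y) z = X.first ≫ h ∧ right (X := X) (Y := Y) z = 0 := by
  let H : ∀ i, X.X (i + 1) ⟶ Y.X i
    | 0 => h ≫ eqToHom Y.h₀.symm
    | _ + 1 => 0
  obtain ⟨m, rfl⟩ : ∃ m, n = m + 1 := ⟨n - 1, by omega⟩
  exact ⟨htpyMap H, by simp [left, htpyMap, H, Ends.first], by simp [right, htpyMap, H]⟩

/-- The morphism is null-homotopic, and in the top degree only the summand `H n` followed by the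
last differential survives. -/
lemma exists_factor_right {X : Ends n A C} {Y : Ends n B D} (hX : X.toCplx.IsNCokernel)
    (u : X.K ⟶ Y.K) (hu : left (X := X) (Y := Y) u = 0) :
    ∃ h : C ⟶ Y.X n, right (X := X) (Y := Y) u = h ≫ Y.last := by
  obtain ⟨H, hH, -⟩ := exists_htpy_of_left (Y := Y.toCplx) hX u (by
    rw [f_eq_left (X := X) (Y := Y) u, hu, zero_comp, comp_zero])
  refine ⟨eqToHom X.h₁.symm ≫ H n, ?_⟩
  rw [right, hH.2, (X.isZero (n + 2) (by omega)).eq_of_src (H (n + 1)) 0]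
  simp [Ends.last]

lemma exists_factor_left {X : Ends n A C} {Y : Ends n B D} (hY : Y.toCplx.IsNKernel)
    (u : X.K ⟶ Y.K) (hu : right (X := X) (Y := Y) u = 0) :
    ∃ h : X.X 1 ⟶ B, left (X := X) (Y := Y) u = X.first ≫ h := by
  obtain ⟨H, hH, -⟩ := exists_htpy_of_right (X := X.toCplx) hY u (by
    rw [f_eq_right (X := X) (Y := Y) u, hu, zero_comp, comp_zero])
  refine ⟨H 0 ≫ eqToHom Y.h₀, ?_⟩
  rw [left, hH.1]
  simp [Ends.first]

/-- Both composites minus the identity vanish in degree `0`, hence are null-homotopic. So morphisms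
both ways that fix the ends suffice for equality of classes. -/
lemma cls_eq_of_isEndsHom {X Y : Ends n A C} (hX : X.toCplx.IsNCokernel)
    (hY : Y.toCplx.IsNCokernel) {f : X.K ⟶ Y.K} {g : Y.K ⟶ X.K}
    (hf : IsEndsHom (X := X) (Y := Y) f) (hg : IsEndsHom (X := Y) (Y := X) g) :
    X.cls = Y.cls := by
  have aux : ∀ (Z : Ends n A C) (_ : Z.toCplx.IsNCokernel) (e : Z.K ⟶ Z.K)
      (_ : IsEndsHom (X := Z) (Y := Z) e), ∃ H, IsNullHtpy (e - 𝟙 Z.K) H := fun Z hZ e he => by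
    obtain ⟨H, hH, -⟩ := exists_htpy_of_left (X := Z.toCplx) (Y := Z.toCplx) hZ (e - 𝟙 Z.K) (by
      rw [f_eq_left (X := Z) (Y := Z), left_sub, he.1, (isEndsHom_id Z).1, sub_self, zero_comp,
        comp_zero])
    exact ⟨H, hH⟩
  obtain ⟨H, hH⟩ := aux X hX _ (hf.comp hg)
  obtain ⟨H', hH'⟩ := aux Y hY _ (hg.comp hf)
  exact Quotient.sound ⟨⟨f, g, hH.homotopy, hH'.homotopy⟩, hf, hg⟩

lemma cls_eq_of_iso {X Y : Ends n A C} {f : X.K ⟶ Y.K} {g : Y.K ⟶ X.K} (hfg : f ≫ g = 𝟙 _)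
    (hgf : g ≫ f = 𝟙 _)
    (hf : IsEndsHom (X := X) (Y := Y) f) (hg : IsEndsHom (X := Y) (Y := X) g) :
    X.cls = Y.cls :=
  Quotient.sound ⟨⟨f, g, .ofEq hfg, .ofEq hgf⟩, hf, hg⟩

end Ends

lemma eqToHom_conj_id {𝒞 : Type u} [Category.{v} 𝒞] {P Q : 𝒞} (h : P = Q) (h' : Q = P) (f : Q ⟶ Q) (hf : f = 𝟙 Q) :
    eqToHom h ≫ f ≫ eqToHom h' = 𝟙 P := by
  simp [hf]

/-! ### Mapping cones and cocones of homotopic morphisms -/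

section Cones

variable {𝒞 : Type u} [Category.{v} 𝒞] [Preadditive 𝒞] [HasZeroObject 𝒞]
  [HasBinaryBiproducts 𝒞]

namespace Cone

variable (n : ℕ) (X Y : ℕ → 𝒞)

lemma inr_fst : ∀ i, inr n X Y i ≫ fst n X Y i = 0
  | 0 => zero_comp
  | i + 1 => by
    by_cases h : i < n
    · simp [inr, fst, h]
    · simp [fst, h]

lemma inr_snd {i : ℕ} (h : i ≤ n) : inr n X Y (i + 1) ≫ snd n X Y (i + 1) = 𝟙 _ := by
  by_cases h' : i < n
  · simp [inr, snd, h']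
  · obtain rfl : i = n := by omega
    simp [inr, snd]

lemma inl_fst {i : ℕ} (h : i < n) : inl n X Y (i + 1) ≫ fst n X Y (i + 1) = 𝟙 _ := by
  simp [inl, fst, h]

/-- The morphism `[1, 0; h, 1]`. -/
def shear (H : ∀ i, X (i + 1) ⟶ Y i) (i : ℕ) : obj n X Y i ⟶ obj n X Y i :=
  𝟙 _ + fst n X Y i ≫ H i ≫ inr n X Y i

lemma shear_neg (H : ∀ i, X (i + 1) ⟶ Y i) (i : ℕ) :
    shear n X Y H i ≫ shear n X Y (fun i => -H i) i = 𝟙 _ := by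
  simp [shear, reassoc_of% (inr_fst n X Y i)]

variable {X Y : CochainComplex 𝒞 ℕ} {f g : X ⟶ Y}

/-- The homotopy equation says exactly that the shear absorbs `f - g`. Truncation must be checked at
both ends: `Y⁰` is missing, whence `H 0 = 0`, and `Xⁿ⁺²` is missing but zero. -/
lemma shear_comm (hX : ∀ i, n + 1 < i → IsZero (X.X i)) {H : ∀ i, X.X (i + 1) ⟶ Y.X i}
    (h : IsNullHtpy (f - g) H) (h₀ : H 0 = 0) (i : ℕ) :
    shear n X.X Y.X H i ≫ d n g i = d n f i ≫ shear n X.X Y.X H (i + 1) := by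
  by_cases hi : i ≤ n
  · have e₁ : H i ≫ inr n X.X Y.X i ≫ d n g i =
        H i ≫ Y.d i (i + 1) ≫ inr n X.X Y.X (i + 1) := by
      cases i with
      | zero => simp [h₀]
      | succ i =>
        simp [d, reassoc_of% (inr_fst n X.X Y.X (i + 1)),
          reassoc_of% (inr_snd n X.X Y.X (i := i) (by omega))]
    have e₂ : d n f i ≫ fst n X.X Y.X (i + 1) ≫ H (i + 1) =
        -(fst n X.X Y.X i ≫ X.d (i + 1) (i + 2) ≫ H (i + 1)) := by
      by_cases hi' : i < n
      · simp [d, reassoc_of% (inr_fst n X.X Y.X (i + 1)),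
          reassoc_of% (inl_fst n X.X Y.X hi')]
      · simp [(hX (i + 2) (by omega)).eq_of_src (H (i + 1)) 0]
    have e₃ : f.f (i + 1) = H i ≫ Y.d i (i + 1) + X.d (i + 1) (i + 2) ≫ H (i + 1) + g.f (i + 1) := by
      rw [← h.2 i]; simp
    simp only [shear, Preadditive.add_comp, Preadditive.comp_add, Category.id_comp,
      Category.comp_id, Category.assoc, e₁]
    rw [reassoc_of% e₂]
    simp only [d, e₃, Preadditive.add_comp, Preadditive.comp_add, Category.assoc,
      Preadditive.neg_comp]
    abel
  · exact (isZero_obj n X.X Y.X (by omega)).eq_of_tgt _ _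

end Cone

lemma coneEnds_last {n : ℕ} {A B C D : 𝒞} {X : Ends n A C} {Y : Ends n B D}
    (f : X.K ⟶ Y.K) : (coneEnds (X := X) (Y := Y) f).last =
      Cone.fst n X.K.X Y.K.X n ≫ eqToHom X.h₁ ≫ right (X := X) (Y := Y) f +
        Cone.snd n X.K.X Y.K.X n ≫ Y.last := by
  have e : (coneEnds (X := X) (Y := Y) f).toCplx.d n = Cone.d n f n := CochainComplex.of_d ..
  have e' (h : Cone.obj n X.K.X Y.K.X (n + 1) = D) : Cone.d n f n ≫ eqToHom h =
      Cone.fst n X.K.X Y.K.X n ≫ eqToHom X.h₁ ≫ right (X := X) (Y := Y) f +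
        Cone.snd n X.K.X Y.K.X n ≫ Y.last := by
    simp [Cone.d, Cone.inl, Cone.inr, right, Ends.last]
  rw [Ends.last, e]
  exact e' _

/-- Homotopic morphisms have isomorphic mapping cones. -/
lemma coneEnds_cls_eq {n : ℕ} {A B C D : 𝒞} {X : Ends n A C} {Y : Ends n B D} {f g : X.K ⟶ Y.K}
    {H : ∀ i, X.X (i + 1) ⟶ Y.X i} (h : IsNullHtpy (f - g) H) (h₀ : H 0 = 0) :
    (coneEnds (X := X) (Y := Y) f).cls = (coneEnds (X := X) (Y := Y) g).cls := by
  have aux : ∀ {f g : X.K ⟶ Y.K} {H : ∀ i, X.X (i + 1) ⟶ Y.X i} (_ : IsNullHtpy (f - g) H)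
      (_ : H 0 = 0), ∃ φ : (coneEnds (X := X) (Y := Y) f).K ⟶ (coneEnds (X := X) (Y := Y) g).K,
      (∀ i, φ.f i = Cone.shear n X.K.X Y.K.X H i) ∧
      IsEndsHom (X := coneEnds (X := X) (Y := Y) f) (Y := coneEnds (X := X) (Y := Y) g) φ := by
    intro f g H h h₀
    refine ⟨CochainComplex.ofHom (Cone.shear n X.K.X Y.K.X H)
      (fun i => by
        have hd (f : X.K ⟶ Y.K) : (coneEnds (X := X) (Y := Y) f).K.d i (i + 1) = Cone.d n f i :=
          CochainComplex.of_d ..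
        have := Cone.shear_comm n X.isZero h h₀ i
        exact (congrArg (Cone.shear n X.K.X Y.K.X H i ≫ ·) (hd g)).trans
          (this.trans (congrArg (· ≫ Cone.shear n X.K.X Y.K.X H (i + 1)) (hd f)).symm)), fun i => rfl, ?_, ?_⟩
    · exact eqToHom_conj_id _ _ (Cone.shear n X.K.X Y.K.X H 0) (by simp [Cone.shear, h₀])
    · exact eqToHom_conj_id _ _ (Cone.shear n X.K.X Y.K.X H (n + 1)) (by simp [Cone.shear, Cone.fst])
  obtain ⟨φ, hφ, hφ'⟩ := aux h h₀
  obtain ⟨ψ, hψ, hψ'⟩ := aux (by simpa using h.neg) (by simp [h₀])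
  refine cls_eq_of_iso (f := φ) (g := ψ) ?_ ?_ hφ' hψ'
  · ext i
    rw [HomologicalComplex.comp_f, hφ, hψ]
    exact Cone.shear_neg ..
  · ext i
    rw [HomologicalComplex.comp_f, hφ, hψ]
    have := Cone.shear_neg n X.K.X Y.K.X (fun i => -H i) i
    simp only [neg_neg] at this
    exact this

namespace Cocone

variable (n : ℕ) (X Y : ℕ → 𝒞)

lemma inr_fst (i : ℕ) : inr n X Y i ≫ fst n X Y (i + 1) = 0 := by
  by_cases h : i < n
  · simp [inr, fst, h]
  · simp [fst, h]

lemma inr_snd {i : ℕ} (h : i ≤ n) : inr n X Y i ≫ snd n X Y i = 𝟙 _ := by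
  by_cases h' : i < n
  · simp [inr, snd, h']
  · obtain rfl : i = n := by omega
    simp [inr, snd]

lemma inl_fst {i : ℕ} (h : i < n) : inl n X Y (i + 1) ≫ fst n X Y (i + 1) = 𝟙 _ := by
  simp [inl, fst, h]

/-- The morphism `[1, 0; -h, 1]`. -/
def shear (H : ∀ i, X (i + 1) ⟶ Y i) : ∀ i, obj n X Y i ⟶ obj n X Y i
  | 0 => 𝟙 _
  | i + 1 => 𝟙 _ - fst n X Y (i + 1) ≫ H i ≫ inr n X Y i

lemma shear_neg (H : ∀ i, X (i + 1) ⟶ Y i) :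
    ∀ i, shear n X Y H i ≫ shear n X Y (fun i => -H i) i = 𝟙 _
  | 0 => Category.id_comp _
  | i + 1 => by simp [shear, reassoc_of% (inr_fst n X Y i)]

variable {X Y : CochainComplex 𝒞 ℕ} {f g : X ⟶ Y}

/-- Now the missing summand is `Xⁿ⁺¹`, the source of `H n`, so that component has to vanish. -/
lemma shear_comm {H : ∀ i, X.X (i + 1) ⟶ Y.X i}
    (h : IsNullHtpy (f - g) H) (hn : H n = 0) (i : ℕ) :
    shear n X.X Y.X H i ≫ d n g i = d n f i ≫ shear n X.X Y.X H (i + 1) := by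
  by_cases hi : i ≤ n
  · have e₂ : d n f i ≫ fst n X.X Y.X (i + 1) ≫ H i = fst n X.X Y.X i ≫ X.d i (i + 1) ≫ H i := by
      by_cases hi' : i < n
      · cases i <;> simp [d, reassoc_of% (inr_fst n X.X Y.X _),
          reassoc_of% (inl_fst n X.X Y.X hi')]
      · obtain rfl : i = n := by omega
        simp [hn]
    cases i with
    | zero =>
      have e₃ : f.f 0 = X.d 0 1 ≫ H 0 + g.f 0 := by rw [← h.1]; simp
      simp only [shear, Preadditive.comp_sub, Category.id_comp, Category.comp_id]
      rw [reassoc_of% e₂]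
      simp only [d, e₃, Preadditive.add_comp, Preadditive.comp_add, Category.assoc]
      abel
    | succ i =>
      have e₁ : inr n X.X Y.X i ≫ d n g (i + 1) = -(Y.d i (i + 1) ≫ inr n X.X Y.X (i + 1)) := by
        simp [d, reassoc_of% (inr_fst n X.X Y.X i),
          reassoc_of% (inr_snd n X.X Y.X (i := i) (by omega))]
      have e₃ : f.f (i + 1) =
          H i ≫ Y.d i (i + 1) + X.d (i + 1) (i + 2) ≫ H (i + 1) + g.f (i + 1) := by
        rw [← h.2 i]; simp
      simp only [shear, Preadditive.sub_comp, Preadditive.comp_sub, Category.id_comp,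
        Category.comp_id, Category.assoc, e₁]
      rw [reassoc_of% e₂]
      simp only [d, e₃, Preadditive.add_comp, Preadditive.comp_add, Category.assoc,
        Preadditive.comp_neg]
      abel
  · exact (isZero_obj n X.X Y.X (by omega)).eq_of_tgt _ _

end Cocone

/-- Homotopic morphisms have isomorphic mapping cocones. -/
lemma coconeEnds_cls_eq {n : ℕ} {A B C D : 𝒞} {X : Ends n A C} {Y : Ends n B D} {f g : X.K ⟶ Y.K}
    {H : ∀ i, X.X (i + 1) ⟶ Y.X i} (h : IsNullHtpy (f - g) H) (hn : H n = 0) :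
    (coconeEnds (X := X) (Y := Y) f).cls = (coconeEnds (X := X) (Y := Y) g).cls := by
  have aux : ∀ {f g : X.K ⟶ Y.K} {H : ∀ i, X.X (i + 1) ⟶ Y.X i} (_ : IsNullHtpy (f - g) H)
      (_ : H n = 0), ∃ φ : (coconeEnds (X := X) (Y := Y) f).K ⟶ (coconeEnds (X := X) (Y := Y) g).K,
      (∀ i, φ.f i = Cocone.shear n X.K.X Y.K.X H i) ∧
      IsEndsHom (X := coconeEnds (X := X) (Y := Y) f) (Y := coconeEnds (X := X) (Y := Y) g) φ := by
    intro f g H h hn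
    refine ⟨CochainComplex.ofHom (Cocone.shear n X.K.X Y.K.X H)
      (fun i => by
        have hd (f : X.K ⟶ Y.K) : (coconeEnds (X := X) (Y := Y) f).K.d i (i + 1) = Cocone.d n f i :=
          CochainComplex.of_d ..
        have := Cocone.shear_comm n h hn i
        exact (congrArg (Cocone.shear n X.K.X Y.K.X H i ≫ ·) (hd g)).trans
          (this.trans (congrArg (· ≫ Cocone.shear n X.K.X Y.K.X H (i + 1)) (hd f)).symm)), fun i => rfl, ?_, ?_⟩
    · exact eqToHom_conj_id _ _ (Cocone.shear n X.K.X Y.K.X H 0) rfl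
    · exact eqToHom_conj_id _ _ (Cocone.shear n X.K.X Y.K.X H (n + 1))
        (by simp [Cocone.shear, Cocone.fst])
  obtain ⟨φ, hφ, hφ'⟩ := aux h hn
  obtain ⟨ψ, hψ, hψ'⟩ := aux (by simpa using h.neg) (by simp [hn])
  refine cls_eq_of_iso (f := φ) (g := ψ) ?_ ?_ hφ' hψ'
  · ext i
    rw [HomologicalComplex.comp_f, hφ, hψ]
    exact Cocone.shear_neg ..
  · ext i
    rw [HomologicalComplex.comp_f, hφ, hψ]
    have := Cocone.shear_neg n X.K.X Y.K.X (fun i => -H i) i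
    simp only [neg_neg] at this
    exact this

end Cones

/-! ### Functoriality and additivity of the extension groups -/

section Extensions

variable {𝒞 : Type u} [Category.{v} 𝒞] {E : 𝒞ᵒᵖ ⥤ 𝒞 ⥤ AddCommGrpCat.{w}}

lemma push_id {A C : 𝒞} (δ : Ext E C A) : push (𝟙 A) δ = δ := by
  simp [push]

lemma pull_id {A C : 𝒞} (δ : Ext E C A) : pull (𝟙 C) δ = δ := by
  simp [pull]

lemma push_push {A A' A'' C : 𝒞} (a : A ⟶ A') (a' : A' ⟶ A'') (δ : Ext E C A) :
    push a' (push a δ) = push (a ≫ a') δ := by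
  simp [push]

lemma pull_pull {A C C' C'' : 𝒞} (c : C' ⟶ C) (c' : C'' ⟶ C') (δ : Ext E C A) :
    pull c' (pull c δ) = pull (c' ≫ c) δ := by
  simp [pull]

lemma push_pull {A A' C C' : 𝒞} (a : A ⟶ A') (c : C' ⟶ C) (δ : Ext E C A) :
    push a (pull c δ) = pull c (push a δ) :=
  (ConcreteCategory.congr_hom ((E.map c.op).naturality a) δ).symm

lemma push_zero {A A' C : 𝒞} (a : A ⟶ A') : push a (0 : Ext E C A) = 0 :=
  map_zero ((E.obj (Opposite.op C)).map a).hom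

lemma pull_zero {A C C' : 𝒞} (c : C' ⟶ C) : pull c (0 : Ext E C A) = 0 :=
  map_zero ((E.map c.op).app A).hom

lemma push_sub {A A' C : 𝒞} (a : A ⟶ A') (δ ρ : Ext E C A) :
    push a (δ - ρ) = push a δ - push a ρ :=
  map_sub ((E.obj (Opposite.op C)).map a).hom δ ρ

lemma pull_add {A C C' : 𝒞} (c : C' ⟶ C) (δ ρ : Ext E C A) :
    pull c (δ + ρ) = pull c δ + pull c ρ :=
  map_add ((E.map c.op).app A).hom δ ρ

variable [Preadditive 𝒞]

lemma add_pull [E.Additive] {A C C' : 𝒞} (c c' : C' ⟶ C) (δ : Ext E C A) :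
    pull (c + c') δ = pull c δ + pull c' δ := by
  simp [pull, Functor.map_add]

lemma zero_pull [E.Additive] {A C C' : 𝒞} (δ : Ext E C A) : pull (0 : C' ⟶ C) δ = 0 := by
  have := add_pull (0 : C' ⟶ C) 0 δ
  simpa using this

end Extensions

/-! ### Extensions realized by conflations and their long exact sequences -/

section Realization

variable {𝒞 : Type u} [Category.{v} 𝒞] [Preadditive 𝒞] {n : ℕ}

lemma mem_conflations_iff {E : 𝒞ᵒᵖ ⥤ 𝒞 ⥤ AddCommGrpCat.{w}} {s : Correspondence E n} {A C : 𝒞}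
    (X : Ends n A C) : X.toCplx ∈ conflations s ↔ ∃ δ : Ext E C A, s.real δ = X.cls := by
  obtain ⟨X, rfl, rfl⟩ := X
  rfl

lemma exists_real {E : 𝒞ᵒᵖ ⥤ 𝒞 ⥤ AddCommGrpCat.{w}} (s : Correspondence E n) {A C : 𝒞}
    (δ : Ext E C A) : ∃ X : Ends n A C, s.real δ = X.cls :=
  ⟨(s.real δ).out, (Quotient.out_eq _).symm⟩

lemma firstMaps_iff {𝒳 : Set (Cplx 𝒞 n)} {A B : 𝒞} {f : A ⟶ B} : firstMaps 𝒳 f ↔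
    ∃ (C : 𝒞) (X : Ends n A C) (h : X.X 1 = B), X.toCplx ∈ 𝒳 ∧ X.first ≫ eqToHom h = f := by
  constructor
  · rintro ⟨X⟩
    exact ⟨_, X.1.ends, rfl, X.2, by simp [Ends.first, Cplx.ends]⟩
  · rintro ⟨C, ⟨X, rfl, rfl⟩, rfl, hX, rfl⟩
    have : firstMaps 𝒳 (X.d 0) := ⟨(⟨X, hX⟩ : 𝒳)⟩
    simpa [Ends.first] using this

lemma lastMaps_iff {𝒳 : Set (Cplx 𝒞 n)} {B C : 𝒞} {f : B ⟶ C} : lastMaps 𝒳 f ↔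
    ∃ (A : 𝒞) (X : Ends n A C) (h : B = X.X n), X.toCplx ∈ 𝒳 ∧ eqToHom h ≫ X.last = f := by
  constructor
  · rintro ⟨X⟩
    exact ⟨_, X.1.ends, rfl, X.2, by simp [Ends.last, Cplx.ends]⟩
  · rintro ⟨C, ⟨X, rfl, rfl⟩, rfl, hX, rfl⟩
    have : lastMaps 𝒳 (X.d n) := ⟨(⟨X, hX⟩ : 𝒳)⟩
    simpa [Ends.last] using this

variable [HasZeroObject 𝒞] [HasBinaryBiproducts 𝒞] {hn : 0 < n}
  {E : 𝒞ᵒᵖ ⥤ 𝒞 ⥤ AddCommGrpCat.{w}} {s : Correspondence E n}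

namespace IsNExangulated

lemma push_first (hs : IsNExangulated hn E s) {A C : 𝒞} {X : Ends n A C} {δ : Ext E C A}
    (hX : s.real δ = X.cls) : push X.first δ = 0 := by
  obtain ⟨X, rfl, rfl⟩ := X
  have := ((hs.exactRealization.r1 X δ hX).2 (X.X 1)).2
  exact (this _).2 ⟨𝟙 _, by simp [Ends.first]⟩

lemma pull_last (hs : IsNExangulated hn E s) {A C : 𝒞} {X : Ends n A C} {δ : Ext E C A}
    (hX : s.real δ = X.cls) : pull X.last δ = 0 := by
  obtain ⟨X, rfl, rfl⟩ := X
  have := ((hs.exactRealization.r1 X δ hX).1 (X.X n)).2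
  exact (this _).2 ⟨𝟙 _, by simp [Ends.last]⟩

lemma exists_of_pull_eq_zero (hs : IsNExangulated hn E s) {A C : 𝒞} {X : Ends n A C}
    {δ : Ext E C A} (hX : s.real δ = X.cls) {Q : 𝒞} (g : Q ⟶ C) (hg : pull g δ = 0) :
    ∃ h, g = h ≫ X.last := by
  obtain ⟨X, rfl, rfl⟩ := X
  obtain ⟨h, hh⟩ := (((hs.exactRealization.r1 X δ hX).1 Q).2 g).1 hg
  exact ⟨h, by simpa [Ends.last] using hh.symm⟩

lemma isNExact (hs : IsNExangulated hn E s)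
    (hmono : ∀ {A B : 𝒞} (f : A ⟶ B), firstMaps (conflations s) f → Mono f)
    (hepi : ∀ {A B : 𝒞} (f : A ⟶ B), lastMaps (conflations s) f → Epi f)
    (X : Cplx 𝒞 n) (hX : X ∈ conflations s) : X.IsNExact := by
  have : Mono (X.d 0) := hmono _ ⟨(⟨X, hX⟩ : conflations s)⟩
  have : Epi (X.d n) := hepi _ ⟨(⟨X, hX⟩ : conflations s)⟩
  obtain ⟨δ, hδ⟩ := hX
  have h := hs.exactRealization.r1 X δ hδ
  exact ⟨fun Q => ⟨fun _ _ hab => (cancel_mono (X.d 0)).1 hab, (h.1 Q).1⟩,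
    fun Q => ⟨fun _ _ hab => (cancel_epi (X.d n)).1 hab, (h.2 Q).1⟩⟩

/-- The sequence `𝒞(Q, C) ⟶ 𝔼(Q, A) ⟶ 𝔼(Q, X¹)` given by a conflation is exact. -/
lemma exists_eq_pull [E.Additive] (hs : IsNExangulated hn E s) {A C : 𝒞} {X : Ends n A C}
    {δ : Ext E C A} (hX : s.real δ = X.cls) {Q : 𝒞} (θ : Ext E Q A) (hθ : push X.first θ = 0) :
    ∃ u : Q ⟶ C, θ = pull u δ := by
  -- Glue `δ` and `θ` into one extension by `C ⊞ Q`. The cone of a good lift of the inclusion of `C`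
  -- realizes the pushforward of `ρ` along `X.first`, whose restriction to `Q` is the pushforward of
  -- `θ`, namely zero. So the inclusion of `Q` factors through the last differential of the cone.
  let ρ : Ext E (C ⊞ Q) A := pull biprod.fst δ + pull biprod.snd θ
  have h₁ : pull biprod.inl ρ = δ := by
    simp [ρ, pull_add, pull_pull, pull_id, zero_pull]
  have h₂ : pull biprod.inr ρ = θ := by
    simp [ρ, pull_add, pull_pull, pull_id, zero_pull]
  obtain ⟨Y, hY⟩ := exists_real s ρ
  obtain ⟨f, -, hf, hM⟩ := hs.ea2 ρ biprod.inl X Y (by rw [h₁, hX]) hY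
  obtain ⟨k, hk⟩ : ∃ k : Q ⟶ Cone.obj n X.K.X Y.K.X n, biprod.inr =
      k ≫ (Cone.fst n X.K.X Y.K.X n ≫ eqToHom X.h₁ ≫ biprod.inl +
        Cone.snd n X.K.X Y.K.X n ≫ Y.last) := by
    obtain ⟨k, hk⟩ := hs.exists_of_pull_eq_zero hM biprod.inr (by rw [← push_pull, h₂, hθ])
    rw [← hf]
    exact ⟨k, hk.trans (congrArg (k ≫ ·) (coneEnds_last f))⟩
  -- Pulling `ρ` back along this factorization, the part through `Y.last` contributes zero and the
  -- part through `C` contributes a pullback of `δ`.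
  refine ⟨k ≫ Cone.fst n X.K.X Y.K.X n ≫ eqToHom X.h₁, ?_⟩
  rw [← h₂, hk]
  simp only [Preadditive.comp_add, add_pull, ← pull_pull, h₁, hs.pull_last hY, pull_zero, add_zero]

/-- Morphisms of conflations are compatible with the extensions that they realize. -/
lemma push_left_eq_pull_right [E.Additive] (hs : IsNExangulated hn E s)
    (hex : ∀ X ∈ conflations s, X.IsNExact) {A B C D : 𝒞} {X : Ends n A C} {Y : Ends n B D}
    {δ : Ext E C A} {ρ : Ext E D B} (hX : s.real δ = X.cls) (hY : s.real ρ = Y.cls)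
    (f : X.K ⟶ Y.K) :
    push (left (X := X) (Y := Y) f) δ = pull (right (X := X) (Y := Y) f) ρ := by
  set a := left (X := X) (Y := Y) f with ha
  set c := right (X := X) (Y := Y) f with hc
  -- The defect of compatibility is a pullback `b^* ρ`; it remains to show that `b` factors through
  -- `Y.last`.
  obtain ⟨b, hb⟩ := hs.exists_eq_pull hY (push a δ - pull c ρ) (by
    rw [push_sub, push_push, push_pull, hs.push_first hY, pull_zero, sub_zero, ha,
      left_comp_first, ← push_push, hs.push_first hX, push_zero])
  have hb' : push a δ = pull (b + c) ρ := by
    rw [add_pull, ← hb, sub_add_cancel]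
  obtain ⟨u, hu, hu'⟩ := hs.exactRealization.r0 δ ρ X Y hX hY a (b + c) hb'
  obtain ⟨h, hh⟩ := exists_factor_right (X := X) (Y := Y)
    (hex _ ((mem_conflations_iff X).2 ⟨δ, hX⟩)).2 (u - f) (by rw [left_sub, hu, sub_self])
  rw [right_sub, hu', ← hc, add_sub_cancel_right] at hh
  rw [hh, ← pull_pull, hs.pull_last hY, pull_zero] at hb
  exact sub_eq_zero.1 hb

end IsNExangulated

end Realization

/-! ### The axioms for the class of conflations -/

section Conflations

variable {𝒞 : Type u} [Category.{v} 𝒞] [Preadditive 𝒞] {n : ℕ}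
  {E : 𝒞ᵒᵖ ⥤ 𝒞 ⥤ AddCommGrpCat.{w}} {s : Correspondence E n}

lemma eCprime_conflations : ECprime (conflations s) := fun X Y h hX => by
  rw [mem_conflations_iff] at hX ⊢
  rwa [← h]

lemma e0_conflations (hex : ∀ X ∈ conflations s, X.IsNExact) :
    E0 (conflations s) := fun X hX => by
  obtain ⟨Z, hZ⟩ := exists_real s (0 : Ext E (X.X (n + 1)) (X.X 0))
  have hX' : X.IsNCokernel := fun Q =>
    ⟨fun _ _ _ => (hX _).eq_of_src _ _, fun i _ f =>
      ⟨fun _ => ⟨0, (hX _).eq_of_src _ _⟩, fun _ => (hX _).eq_of_src _ _⟩⟩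
  -- Zero morphisms are identities on zero end terms, so they compare `X` with any realization of
  -- `0`.
  refine ⟨0, hZ.trans (cls_eq_of_isEndsHom (Y := X.ends) (f := 0) (g := 0)
    (hex _ ((mem_conflations_iff Z).2 ⟨0, hZ⟩)).2 hX' ⟨?_, ?_⟩ ⟨?_, ?_⟩)⟩
  · exact (hX _).eq_of_src _ _
  · exact (hX _).eq_of_src _ _
  · exact (hX _).eq_of_src _ _
  · exact (hX _).eq_of_src _ _

variable [HasZeroObject 𝒞] [HasBinaryBiproducts 𝒞] {hn : 0 < n}

namespace IsNExangulated

/-- An `n`-exact sequence that starts with an inflation receives a morphism from a conflation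
with the same end terms. -/
lemma exists_hom_from_conflation (hs : IsNExangulated hn E s)
    (hex : ∀ X ∈ conflations s, X.IsNExact) {A C : 𝒞} (Y : Ends n A C) (hY : Y.toCplx.IsNExact)
    (h : firstMaps (conflations s) Y.first) :
    ∃ V : Ends n A C, V.toCplx ∈ conflations s ∧
      ∃ v : V.K ⟶ Y.K, IsEndsHom (X := V) (Y := Y) v := by
  obtain ⟨D, Z, e, hZ, hZY⟩ := firstMaps_iff.1 h
  obtain ⟨ζ, hζ⟩ := (mem_conflations_iff Z).1 hZ
  have hZY' : Z.first = Y.first ≫ eqToHom e.symm := by simp [← hZY]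
  obtain ⟨p, hp, -⟩ := exists_hom (hex _ hZ).2 hY.1 0 (Nat.zero_le n)
    (eqToHom (Z.h₀.trans Y.h₀.symm)) (eqToHom e) (by
      simpa [Ends.first] using (congrArg (eqToHom Z.h₀ ≫ ·) hZY).symm)
  obtain ⟨q, hq, -⟩ := exists_hom hY.2 (hex _ hZ).1 0 (Nat.zero_le n)
    (eqToHom (Y.h₀.trans Z.h₀.symm)) (eqToHom e.symm) (by
      simpa [Ends.first] using (congrArg (eqToHom Y.h₀ ≫ ·) hZY'))
  have hp' : left (X := Z) (Y := Y) p = 𝟙 A := by simp [left, hp]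
  have hq' : left (X := Y) (Y := Z) q = 𝟙 A := by simp [left, hq]
  -- The right end of `q ≫ p` is the identity only up to `k ≫ Y.last`; subtracting the
  -- null-homotopic `z` below removes this error.
  obtain ⟨k, hk⟩ := exists_factor_right (X := Y) (Y := Y) hY.2 (q ≫ p - 𝟙 Y.K) (by
    rw [left_sub, left_comp (Y := Z), hp', hq', (isEndsHom_id Y).1, Category.comp_id, sub_self])
  rw [right_sub, right_comp (Y := Z), (isEndsHom_id Y).2] at hk
  obtain ⟨V, hV⟩ := exists_real s (pull (right (X := Y) (Y := Z) q) ζ)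
  obtain ⟨t, ht, ht'⟩ := hs.exactRealization.r0 _ ζ V Z hV hζ (𝟙 A) (right (X := Y) (Y := Z) q)
    (push_id _)
  obtain ⟨z, hz, hz'⟩ := exists_right_correction hn V Y k
  refine ⟨V, (mem_conflations_iff V).2 ⟨_, hV⟩, t ≫ p - z, ?_, ?_⟩
  · rw [left_sub, left_comp (Y := Z), ht, hp', hz, Category.comp_id, sub_zero]
  · rw [right_sub, right_comp (Y := Z), ht', hz', ← hk, sub_sub_cancel]

/-- An `n`-exact sequence that ends with a deflation maps to a conflation with the same end
terms. -/
lemma exists_hom_to_conflation (hs : IsNExangulated hn E s)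
    (hex : ∀ X ∈ conflations s, X.IsNExact) {A C : 𝒞} (Y : Ends n A C) (hY : Y.toCplx.IsNExact)
    (h : lastMaps (conflations s) Y.last) :
    ∃ V : Ends n A C, V.toCplx ∈ conflations s ∧
      ∃ v : Y.K ⟶ V.K, IsEndsHom (X := Y) (Y := V) v := by
  obtain ⟨D, Z, e, hZ, hZY⟩ := lastMaps_iff.1 h
  obtain ⟨ζ, hζ⟩ := (mem_conflations_iff Z).1 hZ
  have hZY' : Z.last = eqToHom e.symm ≫ Y.last := by simp [← hZY]
  obtain ⟨p, -, hp⟩ := exists_hom (hex _ hZ).2 hY.1 n le_rfl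
    (eqToHom e.symm) (eqToHom (Z.h₁.trans Y.h₁.symm)) (by
      simpa [Ends.last] using (congrArg (· ≫ eqToHom Y.h₁.symm) hZY').symm)
  obtain ⟨q, -, hq⟩ := exists_hom hY.2 (hex _ hZ).1 n le_rfl
    (eqToHom e) (eqToHom (Y.h₁.trans Z.h₁.symm)) (by
      simpa [Ends.last] using (congrArg (· ≫ eqToHom Z.h₁.symm) hZY))
  have hp' : right (X := Z) (Y := Y) p = 𝟙 C := by simp [right, hp]
  have hq' : right (X := Y) (Y := Z) q = 𝟙 C := by simp [right, hq]
  obtain ⟨k, hk⟩ := exists_factor_left (X := Y) (Y := Y) hY.1 (q ≫ p - 𝟙 Y.K) (by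
    rw [right_sub, right_comp (Y := Z), hp', hq', (isEndsHom_id Y).2, Category.comp_id, sub_self])
  rw [left_sub, left_comp (Y := Z), (isEndsHom_id Y).1] at hk
  obtain ⟨V, hV⟩ := exists_real s (push (left (X := Z) (Y := Y) p) ζ)
  obtain ⟨t, ht, ht'⟩ := hs.exactRealization.r0 ζ _ Z V hζ hV (left (X := Z) (Y := Y) p) (𝟙 C)
    (pull_id _).symm
  obtain ⟨z, hz, hz'⟩ := exists_left_correction hn Y V k
  refine ⟨V, (mem_conflations_iff V).2 ⟨_, hV⟩, q ≫ t - z, ?_, ?_⟩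
  · rw [left_sub, left_comp (Y := Z), ht, hz, ← hk, sub_sub_cancel]
  · rw [right_sub, right_comp (Y := Z), ht', hq', hz', Category.comp_id, sub_zero]

/-- By (R2) identities are inflations, and `f ≫ inv f` is one, so (a) applies. -/
lemma firstMaps_of_isIso (hs : IsNExangulated hn E s)
    (ha : ∀ {A B C : 𝒞} (a : A ⟶ B) (b : B ⟶ C),
      firstMaps (conflations s) (a ≫ b) → firstMaps (conflations s) a)
    {A B : 𝒞} (f : A ⟶ B) [IsIso f] : firstMaps (conflations s) f := by
  refine ha f (inv f) (firstMaps_iff.2 ⟨_, idLeft hn A, rfl,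
    (mem_conflations_iff _).2 ⟨0, hs.exactRealization.r2 A⟩, ?_⟩)
  have h : (idLeft hn A).d 0 = 𝟙 A := CochainComplex.of_d (idLeftObj A) (idLeftD A) 0
  have h' : (idLeft hn A).first = 𝟙 A := (Category.id_comp _).trans h
  rw [h', IsIso.hom_inv_id]
  exact Category.id_comp _

lemma lastMaps_of_isIso (hs : IsNExangulated hn E s)
    (hb : ∀ {A B C : 𝒞} (a : A ⟶ B) (b : B ⟶ C),
      lastMaps (conflations s) (a ≫ b) → lastMaps (conflations s) b)
    {A B : 𝒞} (f : A ⟶ B) [IsIso f] : lastMaps (conflations s) f := by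
  have e : (idRight hn B).X n = B := if_pos (Or.inl rfl)
  refine hb (inv f) f (lastMaps_iff.2 ⟨_, idRight hn B, e.symm,
    (mem_conflations_iff _).2 ⟨0, hs.exactRealization.r2_op B⟩, ?_⟩)
  have h : (idRight hn B).d n = eqToHom (e.trans (idRight hn B).h₁.symm) :=
    (CochainComplex.of_d (idRightObj n B) (fun i => if h : i = n then
      eqToHom (by simp [idRightObj, h]) else 0) n).trans (dif_pos rfl)
  rw [Ends.last, h, IsIso.inv_hom_id]
  simp

variable [E.Additive]

lemma e2prime (hs : IsNExangulated hn E s) (hex : ∀ X ∈ conflations s, X.IsNExact) :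
    E2prime (conflations s) := by
  constructor
  · intro A A' C a X hX
    obtain ⟨δ, hδ⟩ := (mem_conflations_iff X).1 hX
    obtain ⟨Y, hY⟩ := exists_real s (push a δ)
    exact ⟨Y, (mem_conflations_iff Y).2 ⟨_, hY⟩,
      hs.exactRealization.r0 δ _ X Y hδ hY a (𝟙 C) (pull_id _).symm⟩
  · intro A A' C X Y hX hY f hf
    obtain ⟨δ, hδ⟩ := (mem_conflations_iff X).1 hX
    obtain ⟨ρ, hρ⟩ := (mem_conflations_iff Y).1 hY
    have h := hs.push_left_eq_pull_right hex hδ hρ f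
    rw [hf, pull_id] at h
    subst h
    -- The cocone of the good lift `g` is a conflation; `f` agrees with `g` on the right end, hence
    -- is homotopic to it with `H n = 0`.
    obtain ⟨g, -, hg, hN⟩ := hs.ea2_op δ _ X Y hδ hρ
    obtain ⟨H, hH, hHn⟩ := exists_htpy_of_right (X := X.toCplx) (hex _ hY).1 (f - g) (by
      rw [f_eq_right (X := X) (Y := Y), right_sub, hf, hg, sub_self, zero_comp, comp_zero])
    exact (mem_conflations_iff (coconeEnds (X := X) (Y := Y) f)).2
      ⟨_, hN.trans (coconeEnds_cls_eq hH hHn).symm⟩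

lemma e2primeOp (hs : IsNExangulated hn E s) (hex : ∀ X ∈ conflations s, X.IsNExact) :
    E2primeOp (conflations s) := by
  constructor
  · intro A C C' c Y hY
    obtain ⟨ρ, hρ⟩ := (mem_conflations_iff Y).1 hY
    obtain ⟨X, hX⟩ := exists_real s (pull c ρ)
    exact ⟨X, (mem_conflations_iff X).2 ⟨_, hX⟩,
      hs.exactRealization.r0 _ ρ X Y hX hρ (𝟙 A) c (push_id _)⟩
  · intro A C C' X Y hX hY f hf
    obtain ⟨δ, hδ⟩ := (mem_conflations_iff X).1 hX
    obtain ⟨ρ, hρ⟩ := (mem_conflations_iff Y).1 hY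
    have h := hs.push_left_eq_pull_right hex hδ hρ f
    rw [hf, push_id] at h
    subst h
    obtain ⟨g, hg, -, hM⟩ := hs.ea2 ρ _ X Y hδ hρ
    obtain ⟨H, hH, hH₀⟩ := exists_htpy_of_left (Y := Y.toCplx) (hex _ hX).2 (f - g) (by
      rw [f_eq_left (X := X) (Y := Y), left_sub, hf, hg, sub_self, zero_comp, comp_zero])
    exact (mem_conflations_iff (coneEnds (X := X) (Y := Y) f)).2
      ⟨_, hM.trans (coneEnds_cls_eq hH hH₀).symm⟩

/-- Compatibility with identity ends makes the two realized extensions equal. -/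
lemma cls_eq_of_mem (hs : IsNExangulated hn E s) (hex : ∀ X ∈ conflations s, X.IsNExact)
    {A C : 𝒞} {X Y : Ends n A C} (hX : X.toCplx ∈ conflations s)
    (hY : Y.toCplx ∈ conflations s) (f : X.K ⟶ Y.K) (hf : IsEndsHom (X := X) (Y := Y) f) :
    X.cls = Y.cls := by
  obtain ⟨δ, hδ⟩ := (mem_conflations_iff X).1 hX
  obtain ⟨ρ, hρ⟩ := (mem_conflations_iff Y).1 hY
  have h := hs.push_left_eq_pull_right hex hδ hρ f
  rw [hf.1, hf.2, push_id, pull_id] at h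
  rw [← hδ, ← hρ, h]

/-- An `n`-exact sequence that starts with an inflation and ends with a deflation is a
conflation. -/
lemma mem_of_first_of_last (hs : IsNExangulated hn E s)
    (hex : ∀ X ∈ conflations s, X.IsNExact) {A C : 𝒞} (Y : Ends n A C) (hY : Y.toCplx.IsNExact)
    (h₀ : firstMaps (conflations s) Y.first) (h₁ : lastMaps (conflations s) Y.last) :
    Y.toCplx ∈ conflations s := by
  obtain ⟨V, hV, v, hv⟩ := hs.exists_hom_from_conflation hex Y hY h₀
  obtain ⟨W, hW, w, hw⟩ := hs.exists_hom_to_conflation hex Y hY h₁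
  obtain ⟨δ, hδ⟩ := (mem_conflations_iff V).1 hV
  have hVW : V.cls = W.cls := hs.cls_eq_of_mem hex hV hW (v ≫ w) (hv.comp hw)
  obtain ⟨g, hg, hg'⟩ := hs.exactRealization.r0 δ δ W V (hδ.trans hVW) hδ (𝟙 _) (𝟙 _)
    (by rw [push_id, pull_id])
  have : IsEndsHom (X := W) (Y := V) g := ⟨hg, hg'⟩
  exact (mem_conflations_iff Y).2
    ⟨δ, hδ.trans (cls_eq_of_isEndsHom (hex _ hV).2 hY.2 hv (hw.comp this))⟩

/-- The conflation mapping to `Y` has a last differential factoring through `Y.last`, so (b) turns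
the latter into a deflation. -/
lemma mem_of_first (hs : IsNExangulated hn E s) (hex : ∀ X ∈ conflations s, X.IsNExact)
    (hb : ∀ {A B C : 𝒞} (a : A ⟶ B) (b : B ⟶ C),
      lastMaps (conflations s) (a ≫ b) → lastMaps (conflations s) b)
    {A C : 𝒞} (Y : Ends n A C) (hY : Y.toCplx.IsNExact)
    (h : firstMaps (conflations s) Y.first) : Y.toCplx ∈ conflations s := by
  refine hs.mem_of_first_of_last hex Y hY h ?_
  obtain ⟨V, hV, v, hv⟩ := hs.exists_hom_from_conflation hex Y hY h
  have hV' : V.last = v.f n ≫ Y.last := by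
    rw [← Category.comp_id V.last, ← hv.2, last_comp_right]
  exact hb (v.f n) Y.last (hV' ▸ lastMaps_iff.2 ⟨_, V, rfl, hV, by simp⟩)

lemma mem_of_last (hs : IsNExangulated hn E s) (hex : ∀ X ∈ conflations s, X.IsNExact)
    (ha : ∀ {A B C : 𝒞} (a : A ⟶ B) (b : B ⟶ C),
      firstMaps (conflations s) (a ≫ b) → firstMaps (conflations s) a)
    {A C : 𝒞} (Y : Ends n A C) (hY : Y.toCplx.IsNExact)
    (h : lastMaps (conflations s) Y.last) : Y.toCplx ∈ conflations s := by
  refine hs.mem_of_first_of_last hex Y hY ?_ h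
  obtain ⟨V, hV, v, hv⟩ := hs.exists_hom_to_conflation hex Y hY h
  have hV' : V.first = Y.first ≫ v.f 1 := by
    rw [← Category.id_comp V.first, ← hv.1, left_comp_first]
  exact ha Y.first (v.f 1) (hV' ▸ firstMaps_iff.2 ⟨_, V, rfl, hV, by simp⟩)

/-- The given morphism passes one admissible end on to `X'`: a deflation by (b) or an inflation by
(a), according to its direction. Then both complexes are conflations. -/
lemma ei (hs : IsNExangulated hn E s) (hex : ∀ X ∈ conflations s, X.IsNExact)
    (ha : ∀ {A B C : 𝒞} (a : A ⟶ B) (b : B ⟶ C),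
      firstMaps (conflations s) (a ≫ b) → firstMaps (conflations s) a)
    (hb : ∀ {A B C : 𝒞} (a : A ⟶ B) (b : B ⟶ C),
      lastMaps (conflations s) (a ≫ b) → lastMaps (conflations s) b) :
    EI (conflations s) := by
  rintro A C X X' hX hX' (⟨f, hf⟩ | ⟨f, hf⟩)
  · have h : X.last = f.f n ≫ X'.last := by
      rw [← Category.comp_id X.last, ← hf.2, last_comp_right]
    have hX'' := hs.mem_of_last hex ha X' hX'
      (hb (f.f n) X'.last (h ▸ lastMaps_iff.2 ⟨_, X, rfl, hX, by simp⟩))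
    exact hs.cls_eq_of_mem hex hX hX'' f hf
  · have h : X.first = X'.first ≫ f.f 1 := by
      rw [← Category.id_comp X.first, ← hf.1, left_comp_first]
    have hX'' := hs.mem_of_first hex hb X' hX'
      (ha X'.first (f.f 1) (h ▸ firstMaps_iff.2 ⟨_, X, rfl, hX, by simp⟩))
    exact (hs.cls_eq_of_mem hex hX'' hX f hf).symm

/-- A homotopy retract of a conflation, among the `n`-exact sequences, is a conflation. -/
lemma mem_of_retract (hs : IsNExangulated hn E s) (hex : ∀ X ∈ conflations s, X.IsNExact)
    (ha : ∀ {A B C : 𝒞} (a : A ⟶ B) (b : B ⟶ C),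
      firstMaps (conflations s) (a ≫ b) → firstMaps (conflations s) a)
    (hb : ∀ {A B C : 𝒞} (a : A ⟶ B) (b : B ⟶ C),
      lastMaps (conflations s) (a ≫ b) → lastMaps (conflations s) b)
    {X Y : Cplx 𝒞 n} (hX : X ∈ conflations s) (hY : Y.IsNExact) (f : X.K ⟶ Y.K) (g : Y.K ⟶ X.K)
    (h : Y.X 1 ⟶ Y.X 0) (hfg : 𝟙 _ = g.f 0 ≫ f.f 0 + Y.d 0 ≫ h) : Y ∈ conflations s := by
  obtain ⟨δ, hδ⟩ := hX
  obtain ⟨W, hW⟩ := exists_real s (push (f.f 0) δ)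
  obtain ⟨F, hF, -⟩ := hs.exactRealization.r0 δ _ X.ends W hδ hW (f.f 0) (𝟙 _) (pull_id _).symm
  have hF' : f.f 0 ≫ W.first = X.d 0 ≫ F.f 1 := by
    rw [← hF, left_comp_first]
    simp [Ends.first, Cplx.ends]
  -- Composing the retraction identity with `W.first` factors this inflation through `Y.d 0`, which
  -- (a) then makes an inflation. Only the degree `0` part of the homotopy is needed.
  have key : W.first = Y.d 0 ≫ (g.f 1 ≫ F.f 1 + h ≫ W.first) := by
    have hW := congrArg (· ≫ W.first) hfg
    have hg : g.f 0 ≫ X.d 0 ≫ F.f 1 = Y.d 0 ≫ g.f 1 ≫ F.f 1 := g.comm_assoc 0 1 _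
    simpa [hF', hg] using hW
  have : firstMaps (conflations s) (Y.d 0) := by
    refine ha (Y.d 0) (g.f 1 ≫ F.f 1 + h ≫ W.first) ?_
    rw [← key]
    exact firstMaps_iff.2 ⟨_, W, rfl, (mem_conflations_iff W).2 ⟨_, hW⟩, by simp⟩
  exact hs.mem_of_first hex hb Y.ends hY (by simpa [Ends.first, Cplx.ends] using this)

lemma isNExactCategory (hs : IsNExangulated hn E s) (hex : ∀ X ∈ conflations s, X.IsNExact)
    (ha : ∀ {A B C : 𝒞} (a : A ⟶ B) (b : B ⟶ C),
      firstMaps (conflations s) (a ≫ b) → firstMaps (conflations s) a)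
    (hb : ∀ {A B C : 𝒞} (a : A ⟶ B) (b : B ⟶ C),
      lastMaps (conflations s) (a ≫ b) → lastMaps (conflations s) b) :
    IsNExactCategory (conflations s) where
  isNExact := hex
  ec_i X Y hX hY f k hk _ _ := by
    -- The inverse square extends to a morphism `g` back. Each composite minus the identity vanishes
    -- in degree `k`, so in degree `0` it factors through the differential: each complex is a
    -- retract of the other in the required sense.
    obtain ⟨g, hg, -⟩ := exists_hom hY.2 hX.1 k hk (inv (f.f k)) (inv (f.f (k + 1))) (by simp)
    obtain ⟨h, hh⟩ := exists_factor_zero hY.1 (𝟙 Y.K - g ≫ f) k hk (by simp [hg])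
    obtain ⟨h', hh'⟩ := exists_factor_zero hX.1 (𝟙 X.K - f ≫ g) k hk (by simp [hg])
    exact ⟨fun hX' => hs.mem_of_retract hex ha hb hX' hY f g h (by rw [← hh]; simp),
      fun hY' => hs.mem_of_retract hex ha hb hY' hX g f h' (by rw [← hh']; simp)⟩
  ec_ii X Y hX hY f _ _ := by
    constructor
    · intro hX'
      have := hs.ea1_op.comp_mem (X.d n) (f.f (n + 1)) ⟨(⟨X, hX'⟩ : conflations s)⟩
        (hs.lastMaps_of_isIso hb _)
      rw [← f.comm] at this
      exact hs.mem_of_last hex ha Y.ends hY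
        (by simpa [Ends.last, Cplx.ends] using hb _ _ this)
    · intro hY'
      have := hs.ea1.comp_mem (f.f 0) (Y.d 0) (hs.firstMaps_of_isIso ha _)
        ⟨(⟨Y, hY'⟩ : conflations s)⟩
      rw [f.comm] at this
      exact hs.mem_of_first hex hb X.ends hX
        (by simpa [Ends.first, Cplx.ends] using ha _ _ this)
  e0 := e0_conflations hex
  e1 := hs.ea1
  e1_op := hs.ea1_op
  e2 X hX B b := by
    obtain ⟨Y, hY, f, hf, hf'⟩ := (hs.e2prime hex).1 b X.ends hX
    -- The cocone is a conflation by (E2′), hence an `n`-cokernel sequence.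
    refine ⟨Y.toCplx, Y.h₀, f, (Category.id_comp _).symm.trans hf,
      (hex _ ((hs.e2prime hex).2 X.ends Y hX hY f hf')).2, ⟨(⟨Y.toCplx, hY⟩ : conflations s)⟩⟩
  e2_op Y hY D c := by
    obtain ⟨X, hX, f, hf, hf'⟩ := (hs.e2primeOp hex).1 c Y.ends hY
    refine ⟨X.toCplx, X.h₁, f, ?_,
      (hex _ ((hs.e2primeOp hex).2 X Y.ends hX hY f hf)).1, ⟨(⟨X.toCplx, hX⟩ : conflations s)⟩⟩
    rw [← hf']
    exact congrArg (eqToHom X.h₁.symm ≫ ·) (Category.comp_id (f.f (n + 1))).symm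

end IsNExangulated

end Conflations

end

end NExangulated

theorem mainTheorem6 {𝒞 : Type*} [CategoryTheory.Category 𝒞] [CategoryTheory.Preadditive 𝒞]
    [CategoryTheory.Limits.HasZeroObject 𝒞] [CategoryTheory.Limits.HasBinaryBiproducts 𝒞]
    {n : ℕ} (hn : 0 < n)
    (E : 𝒞ᵒᵖ ⥤ 𝒞 ⥤ AddCommGrpCat) [E.Additive]
    [∀ C : 𝒞ᵒᵖ, (E.obj C).Additive]
    (s : NExangulated.Correspondence E n)
    (hs : NExangulated.IsNExangulated hn E s)
    (hmono : ∀ {A B : 𝒞} (f : A ⟶ B),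
      NExangulated.firstMaps (NExangulated.conflations s) f → CategoryTheory.Mono f)
    (hepi : ∀ {A B : 𝒞} (f : A ⟶ B),
      NExangulated.lastMaps (NExangulated.conflations s) f → CategoryTheory.Epi f) :
    ((∀ X ∈ NExangulated.conflations s, X.IsNExact) ∧
      NExangulated.ECprime (NExangulated.conflations s) ∧
      NExangulated.E0 (NExangulated.conflations s) ∧
      NExangulated.E1 (NExangulated.conflations s) ∧
      NExangulated.E1op (NExangulated.conflations s) ∧
      NExangulated.E2prime (NExangulated.conflations s) ∧
      NExangulated.E2primeOp (NExangulated.conflations s)) ∧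
    ((∀ {A B C : 𝒞} (a : A ⟶ B) (b : B ⟶ C),
        NExangulated.firstMaps (NExangulated.conflations s) (a ≫ b) →
        NExangulated.firstMaps (NExangulated.conflations s) a) →
      (∀ {A B C : 𝒞} (a : A ⟶ B) (b : B ⟶ C),
        NExangulated.lastMaps (NExangulated.conflations s) (a ≫ b) →
        NExangulated.lastMaps (NExangulated.conflations s) b) →
      NExangulated.EI (NExangulated.conflations s) ∧
      NExangulated.IsNExactCategory (NExangulated.conflations s)) :=
  have hex := hs.isNExact hmono hepi
  ⟨⟨hex, NExangulated.eCprime_conflations, NExangulated.e0_conflations hex, hs.ea1, hs.ea1_op,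
    hs.e2prime hex, hs.e2primeOp hex⟩,
    fun ha hb => ⟨hs.ei hex ha hb, hs.isNExactCategory hex ha hb⟩⟩
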